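/- Let $V$ be a finite set of terminals, $G=(V,E)$ a directed graph (loops allowed), and let $m(0),m(1),m(2),\dots$ be a Markov chain on $V$, with arbitrary initial law and with an irreducible transition probability matrix $\mathbf P=(P_{i,j})_{i,j\in V}$ such that $P_{i,j}=0$ whenever $(i,j)\notin E$. For $i\in V$ let the age $A_i(t)$ start from an arbitrary deterministic real value $A_i(0)$ and evolve by $A_i(t+1)=1$ if $m(t)=i$ and $A_i(t+1)=A_i(t)+1$ if $m(t)\ne i$. For $T\ge 1$ put $$A^{\mathrm p}_{i,T}=\frac{\sum_{t=1}^{T}A_i(t)\,\mathbf 1_{\{m(t)=i\}}}{\sum_{t=1}^{T}\mathbf 1_{\{m(t)=i\}}},\qquad A^{\mathrm{ave}}_{i,T}=\frac1T\sum_{t=1}^{T}A_i(t)$$ (with $A^{\mathrm p}_{i,T}=0$ if $i$ is not visited at times $1,\dots,T$), $A^{\mathrm p}_i=\limsup_{T\to\infty}A^{\mathrm p}_{i,T}$ and $A^{\mathrm{ave}}_i=\limsup_{T\to\infty}A^{\mathrm{ave}}_{i,T}$. For weights $w_i>0$ let the network peak age and the network average age be $A^{\mathrm p}=\sum_{i\in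 V}w_iA^{\mathrm p}_i$ and $A^{\mathrm{ave}}=\sum_{i\in V}w_iA^{\mathrm{ave}}_i$. Then $\mathbf P$ has a unique stationary distribution $\pi$ (a probability vector with $\pi\mathbf P=\pi$); all $\pi_i$ are positive; the matrix $I-\mathbf P+\Pi$, where $\Pi_{i,j}=\pi_j$ for all $i,j\in V$, is invertible; and, with $z_{ii}$ the diagonal entries of $Z=(I-\mathbf P+\Pi)^{-1}$, almost surely $$A^{\mathrm p}=\sum_{i\in V}\frac{w_i}{\pi_i}\qquad\text{and}\qquad A^{\mathrm{ave}}=\sum_{i\in V}\frac{w_i z_{ii}}{\pi_i}.$$ The same values are obtained in expectation: for every $i\in V$, $\lim_{T\to\infty}\mathbb E[A^{\mathrm p}_{i,T}]=1/\pi_i$ and $\lim_{T\to\infty}\mathbb E[A^{\mathrm{ave}}_{i,T}]=z_{ii}/\pi_i$. -/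

import Mathlib

open MeasureTheory Filter Topology

noncomputable section

namespace AgeOfInformation

variable {V : Type*} [Fintype V] [DecidableEq V]

/-- The `V`-valued process `m` on the probability space `(Ω, μ)` is a time-homogeneous Markov chain
with transition matrix `P` and arbitrary initial law: conditionally on the whole history
`m 0 = x 0, …, m t = x t`, the next state is `x (t + 1)` with probability `P (x t) (x (t + 1))`.
It is written in product form, so that histories of probability zero need no convention. -/
structure IsMarkovChain [MeasurableSpace V] {Ω : Type*} [MeasurableSpace Ω]
    (P : Matrix V V ℝ) (m : ℕ → Ω → V) (μ : Measure Ω) : Prop where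
  measurable : ∀ t, Measurable (m t)
  transition : ∀ (t : ℕ) (x : ℕ → V),
    μ.real {ω | ∀ s ≤ t + 1, m s ω = x s} =
      μ.real {ω | ∀ s ≤ t, m s ω = x s} * P (x t) (x (t + 1))

/-- A randomized trajectory on the mobility graph `G` (a directed graph in which loops are allowed):
a Markov chain with irreducible transition matrix `P` that only moves along edges of `G`. -/
structure IsRandomizedTrajectory [MeasurableSpace V] {Ω : Type*} [MeasurableSpace Ω]
    (G : Digraph V) (P : Matrix V V ℝ) (m : ℕ → Ω → V) (μ : Measure Ω) : Prop where
  stochastic : P ∈ Matrix.rowStochastic ℝ V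
  irreducible : P.IsIrreducible
  support : ∀ i j, ¬ G.Adj i j → P i j = 0
  markov : IsMarkovChain P m μ

/-- `π` is a stationary distribution of `P`: a probability vector with `π P = π`. -/
structure IsStationaryDistribution (P : Matrix V V ℝ) (π : V → ℝ) : Prop where
  nonneg : ∀ i, 0 ≤ π i
  sum_eq_one : ∑ i, π i = 1
  stationary : Matrix.vecMul π P = π

/-- The matrix `Π` with entries `Π i j = π j`. -/
def stationaryMatrix (π : V → ℝ) : Matrix V V ℝ := Matrix.of fun _ j => π j

/-- The fundamental matrix `Z = (I - P + Π)⁻¹`. -/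
def fundamentalMatrix (P : Matrix V V ℝ) (π : V → ℝ) : Matrix V V ℝ :=
  (1 - P + stationaryMatrix π)⁻¹

/-- The age `A_i(t)` of terminal `i` along the path `m`, with initial ages `A_i(0) = a i`. -/
def age (m : ℕ → V) (a : V → ℝ) (i : V) : ℕ → ℝ
  | 0 => a i
  | t + 1 => if m t = i then 1 else age m a i t + 1

/-- The average of the age peaks of terminal `i` in the time slots `1, …, T`
(equal to `0` if `i` is not visited in these slots). -/
def peakAverage (m : ℕ → V) (a : V → ℝ) (i : V) (T : ℕ) : ℝ :=
  (∑ t ∈ Finset.Icc 1 T, if m t = i then age m a i t else 0) /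
    (∑ t ∈ Finset.Icc 1 T, if m t = i then 1 else 0)

/-- The average of the age of terminal `i` over the time slots `1, …, T`. -/
def timeAverage (m : ℕ → V) (a : V → ℝ) (i : V) (T : ℕ) : ℝ :=
  (1 / (T : ℝ)) * ∑ t ∈ Finset.Icc 1 T, age m a i t

/-- The peak age of terminal `i`; the upper limit is taken in the extended reals. -/
def peakAge (m : ℕ → V) (a : V → ℝ) (i : V) : EReal :=
  limsup (fun T : ℕ => (peakAverage m a i T : EReal)) atTop

/-- The average age of terminal `i`; the upper limit is taken in the extended reals. -/
def averageAge (m : ℕ → V) (a : V → ℝ) (i : V) : EReal :=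
  limsup (fun T : ℕ => (timeAverage m a i T : EReal)) atTop

/-- The network peak age with weights `w`. -/
def networkPeakAge (w : V → ℝ) (m : ℕ → V) (a : V → ℝ) : EReal :=
  ∑ i, (w i : EReal) * peakAge m a i

/-- The network average age with weights `w`. -/
def networkAverageAge (w : V → ℝ) (m : ℕ → V) (a : V → ℝ) : EReal :=
  ∑ i, (w i : EReal) * averageAge m a i

end AgeOfInformation

end

/-! Fix `i` and let `g = meanHitting P π i`, so `g j = (z_ii - z_ji) / π i`. Only its equation `P g
= g - 1 + 1_i / π i` is used (`mulVec_meanHitting`), together with `g i = 0` and `g ≥ 1` off `i`.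
Every quantity is written exactly as a linear term plus boundary terms plus a martingale, so neither
regeneration cycles nor aperiodicity are needed.

Peak age: the peaks telescope (`sum_peaks`), so their average is about `T` divided by the number of
visits, and summing the equation of `g` along the path gives about `π i * T` visits (`visits_eq`).

Average age: the reset rule gives `A(t+1) (1 + P g(m t)) = A(t) g(m t) + 1 + P g(m t)`, whether or
not `m t = i`. Summed over time (`sum_age_eq`), this reduces the sum of ages to that of `1 + P g(m
t)`, whose stationary mean is `1 + π g = z_ii / π i`; the Poisson equation handles the fluctuation.

The martingales are `o(T)` by a strong law for orthogonal increments. Their weights include the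
unbounded age, whose second moment is bounded by means of the Lyapunov function `A² g`.

In expectation, the martingales of the average age have mean zero. For the peak age, dominated
convergence applies when there are many visits, and an exponential moment bound makes few visits too
unlikely to matter. -/

namespace AgeOfInformation

/-! ### Stationary law, fundamental matrix and mean hitting times. -/

section LinearAlgebra

open Matrix

variable {V : Type*} [Fintype V] [DecidableEq V] {P : Matrix V V ℝ} {π : V → ℝ}

/-- A harmonic function of an irreducible stochastic matrix is constant. -/
theorem eq_of_mulVec_eq_self (hs : P ∈ rowStochastic ℝ V) (hi : P.IsIrreducible)
    {x : V → ℝ} (hx : P *ᵥ x = x) (i j : V) : x i = x j := by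
  obtain ⟨k, -, hk⟩ := Finset.exists_max_image Finset.univ x ⟨i, Finset.mem_univ i⟩
  have hpow : ∀ n : ℕ, P ^ n *ᵥ x = x := by
    intro n
    induction n with
    | zero => simp
    | succ n ih => rw [pow_succ, ← mulVec_mulVec, hx, ih]
  have key : ∀ l, x l = x k := by
    intro l
    obtain ⟨n, -, hn⟩ := (isIrreducible_iff_exists_pow_pos hi.nonneg).1 hi k l
    have hPn : P ^ n ∈ rowStochastic ℝ V := pow_mem hs n
    have hsum : ∑ j, (P ^ n) k j = 1 := sum_row_of_mem_rowStochastic hPn k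
    -- Maximum principle: a weighted sum of the nonnegative gaps `x k - x j` vanishes, and the
    -- weight at `l` is positive.
    have h1 : ∑ j, (P ^ n) k j * (x k - x j) = 0 := by
      have := congrFun (hpow n) k
      simp only [mulVec, dotProduct] at this
      simp only [mul_sub, Finset.sum_sub_distrib, ← Finset.sum_mul, hsum, this]
      ring
    have h2 := (Finset.sum_eq_zero_iff_of_nonneg (fun j _ => mul_nonneg (hPn.1 k j)
      (sub_nonneg.2 (hk j (Finset.mem_univ j))))).1 h1 l (Finset.mem_univ l)
    rcases mul_eq_zero.1 h2 with h | h
    · exact absurd h hn.ne'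
    · linarith
  rw [key i, key j]

theorem IsStationaryDistribution.vecMul_pow (hπ : IsStationaryDistribution P π) (n : ℕ) :
    π ᵥ* P ^ n = π := by
  induction n with
  | zero => simp
  | succ n ih => rw [pow_succ, ← vecMul_vecMul, ih, hπ.stationary]

theorem IsStationaryDistribution.pos (hi : P.IsIrreducible) (hs : P ∈ rowStochastic ℝ V)
    (hπ : IsStationaryDistribution P π) (i : V) : 0 < π i := by
  obtain ⟨j, hj⟩ : ∃ j, 0 < π j := by
    by_contra! h
    have := hπ.sum_eq_one
    have h2 : ∑ i, π i ≤ 0 := Finset.sum_nonpos fun i _ => h i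
    linarith
  obtain ⟨n, -, hn⟩ := (isIrreducible_iff_exists_pow_pos hi.nonneg).1 hi j i
  have hPn : P ^ n ∈ rowStochastic ℝ V := pow_mem hs n
  have h := congrFun (hπ.vecMul_pow n) i
  simp only [vecMul, dotProduct] at h
  rw [← h]
  exact lt_of_lt_of_le (mul_pos hj hn) (Finset.single_le_sum
    (f := fun x => π x * (P ^ n) x i)
    (fun x _ => mul_nonneg (hπ.nonneg x) (hPn.1 x i)) (Finset.mem_univ j))

/-- `1 - P` kills constants, hence has a left null vector `v`. Entrywise `|v| ≤ |v| P`, and both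
sides have the same total since rows sum to one; so `|v|` is invariant too and only needs
normalising. -/
theorem exists_isStationaryDistribution [Nonempty V] (hs : P ∈ rowStochastic ℝ V) :
    ∃ π, IsStationaryDistribution P π := by
  have hdet : (1 - P).det = 0 := exists_mulVec_eq_zero_iff.1
    ⟨1, one_ne_zero, by rw [sub_mulVec, one_mulVec, hs.2, sub_self]⟩
  obtain ⟨v, hv0, hv⟩ := exists_vecMul_eq_zero_iff.2 hdet
  rw [vecMul_sub, vecMul_one, sub_eq_zero] at hv
  have hle : ∀ j, |v j| ≤ ∑ i, |v i| * P i j := by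
    intro j
    have h := congrFun hv j
    simp only [vecMul, dotProduct] at h
    calc |v j| = |∑ i, v i * P i j| := by rw [← h]
      _ ≤ ∑ i, |v i * P i j| := Finset.abs_sum_le_sum_abs _ _
      _ = _ := Finset.sum_congr rfl fun i _ => by rw [abs_mul, abs_of_nonneg (hs.1 i j)]
  have htot : ∑ j, |v j| = ∑ j, ∑ i, |v i| * P i j := by
    rw [Finset.sum_comm]
    exact Finset.sum_congr rfl fun i _ => by
      rw [← Finset.mul_sum, sum_row_of_mem_rowStochastic hs i, mul_one]
  have heq := (Finset.sum_eq_sum_iff_of_le fun j _ => hle j).1 htot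
  have hpos : 0 < ∑ j, |v j| := by
    obtain ⟨k, hk⟩ := Function.ne_iff.1 hv0
    exact lt_of_lt_of_le (abs_pos.2 hk) (Finset.single_le_sum (f := fun j => |v j|)
      (fun j _ => abs_nonneg _) (Finset.mem_univ k))
  refine ⟨fun i => |v i| / ∑ j, |v j|, fun i => by positivity, ?_, ?_⟩
  · rw [← Finset.sum_div, div_self hpos.ne']
  · ext j
    simp only [vecMul, dotProduct]
    rw [heq j (Finset.mem_univ j), Finset.sum_div]
    exact Finset.sum_congr rfl fun i _ => by ring

theorem vecMul_stationaryMatrix {V : Type*} [Fintype V] {π ρ : V → ℝ} (hρ : ∑ i, ρ i = 1) :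
    ρ ᵥ* stationaryMatrix π = π := by
  ext j
  simp [vecMul, dotProduct, stationaryMatrix, ← Finset.sum_mul, hρ]

/-- Here `ρ` and `π` may differ: once the matrix is invertible, this yields uniqueness. -/
theorem IsStationaryDistribution.vecMul_eq {ρ : V → ℝ} (hρ : IsStationaryDistribution P ρ) :
    ρ ᵥ* (1 - P + stationaryMatrix π) = π := by
  rw [vecMul_add, vecMul_sub, vecMul_one, hρ.stationary, sub_self, zero_add,
    vecMul_stationaryMatrix hρ.sum_eq_one]

theorem stationaryMatrix_mulVec {V : Type*} [Fintype V] {π : V → ℝ} (x : V → ℝ) :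
    stationaryMatrix π *ᵥ x = fun _ => π ⬝ᵥ x := rfl

/-- For `x` in the kernel, pairing with `π` gives `π ⬝ᵥ x = 0`. Then `x` is harmonic, hence
constant, and the constant is `π ⬝ᵥ x`. -/
theorem IsStationaryDistribution.isUnit (hi : P.IsIrreducible) (hs : P ∈ rowStochastic ℝ V)
    (hπ : IsStationaryDistribution P π) : IsUnit (1 - P + stationaryMatrix π) := by
  refine mulVec_injective_iff_isUnit.1 ?_
  refine (injective_iff_map_eq_zero (mulVecLin (1 - P + stationaryMatrix π))).2 fun x hx => ?_
  simp only [mulVecLin_apply] at hx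
  have h0 : π ⬝ᵥ x = 0 := by
    rw [← hπ.vecMul_eq (π := π), ← dotProduct_mulVec, hx, dotProduct_zero]
  have hPx : P *ᵥ x = x := by
    rw [add_mulVec, sub_mulVec, one_mulVec, stationaryMatrix_mulVec, h0] at hx
    ext i
    have := congrFun hx i
    simp only [Pi.add_apply, Pi.sub_apply, Pi.zero_apply] at this
    linarith
  ext i
  have : π ⬝ᵥ x = x i := by
    simp only [dotProduct]
    rw [Finset.sum_congr rfl fun j _ => by rw [eq_of_mulVec_eq_self hs hi hPx j i],
      ← Finset.sum_mul, hπ.sum_eq_one, one_mul]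
  rw [← this, h0]; rfl

theorem IsStationaryDistribution.unique (hi : P.IsIrreducible) (hs : P ∈ rowStochastic ℝ V)
    {ρ : V → ℝ} (hρ : IsStationaryDistribution P ρ) (hπ : IsStationaryDistribution P π) :
    ρ = π :=
  vecMul_injective_iff_isUnit.2 (hπ.isUnit hi hs) (by
    change ρ ᵥ* _ = π ᵥ* _
    rw [hρ.vecMul_eq, hπ.vecMul_eq])

theorem IsStationaryDistribution.vecMul_fundamentalMatrix (hi : P.IsIrreducible)
    (hs : P ∈ rowStochastic ℝ V) (hπ : IsStationaryDistribution P π) :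
    π ᵥ* fundamentalMatrix P π = π := by
  have hu := (isUnit_iff_isUnit_det _).1 (hπ.isUnit hi hs)
  calc π ᵥ* fundamentalMatrix P π
      = (π ᵥ* (1 - P + stationaryMatrix π)) ᵥ* fundamentalMatrix P π := by rw [hπ.vecMul_eq]
    _ = π := by rw [vecMul_vecMul, fundamentalMatrix, mul_nonsing_inv _ hu, vecMul_one]

/-- The fundamental matrix solves the Poisson equation `(1 - P) h = f - π f`. -/
theorem IsStationaryDistribution.poisson (hi : P.IsIrreducible)
    (hs : P ∈ rowStochastic ℝ V) (hπ : IsStationaryDistribution P π) (f : V → ℝ) (j : V) :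
    (fundamentalMatrix P π *ᵥ f) j - (P *ᵥ (fundamentalMatrix P π *ᵥ f)) j = f j - π ⬝ᵥ f := by
  have hu := (isUnit_iff_isUnit_det _).1 (hπ.isUnit hi hs)
  have h : (1 - P + stationaryMatrix π) *ᵥ (fundamentalMatrix P π *ᵥ f) = f := by
    rw [mulVec_mulVec, fundamentalMatrix, mul_nonsing_inv _ hu, one_mulVec]
  have h := congrFun h j
  rw [add_mulVec, sub_mulVec, one_mulVec, stationaryMatrix_mulVec, dotProduct_mulVec,
    hπ.vecMul_fundamentalMatrix hi hs] at h
  simp only [Pi.add_apply, Pi.sub_apply] at h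
  linarith

/-- The mean time to reach `i` from `j`, in terms of the fundamental matrix. -/
noncomputable def meanHitting (P : Matrix V V ℝ) (π : V → ℝ) (i j : V) : ℝ :=
  (fundamentalMatrix P π i i - fundamentalMatrix P π j i) / π i

@[simp] theorem meanHitting_self (i : V) : meanHitting P π i i = 0 := by simp [meanHitting]

/-- The first-step equation: it is the Poisson equation for the indicator of `i`, whose solution is
column `i` of the fundamental matrix. -/
theorem IsStationaryDistribution.mulVec_meanHitting (hi : P.IsIrreducible)
    (hs : P ∈ rowStochastic ℝ V) (hπ : IsStationaryDistribution P π) (i j : V) :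
    (P *ᵥ meanHitting P π i) j = meanHitting P π i j - 1 + if j = i then 1 / π i else 0 := by
  have hp := (hπ.pos hi hs i).ne'
  have h := hπ.poisson hi hs (Pi.single i 1) j
  simp only [mulVec_single_one, dotProduct_single_one, col_apply, Pi.single_apply] at h
  have h3 : (P *ᵥ meanHitting P π i) j =
      (fundamentalMatrix P π i i - (P *ᵥ (fundamentalMatrix P π).col i) j) / π i := by
    simp only [mulVec, dotProduct, meanHitting, col_apply]
    rw [eq_div_iff hp, Finset.sum_mul,
      Finset.sum_congr rfl fun k _ => show P j k * ((fundamentalMatrix P π i i -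
        fundamentalMatrix P π k i) / π i) * π i = P j k * fundamentalMatrix P π i i -
        P j k * fundamentalMatrix P π k i by field_simp,
      Finset.sum_sub_distrib, ← Finset.sum_mul, sum_row_of_mem_rowStochastic hs j, one_mul]
  rw [h3, meanHitting]
  split_ifs at h ⊢ <;> field_simp <;> linarith

theorem IsStationaryDistribution.dotProduct_meanHitting (hi : P.IsIrreducible)
    (hs : P ∈ rowStochastic ℝ V) (hπ : IsStationaryDistribution P π) (i : V) :
    π ⬝ᵥ meanHitting P π i = fundamentalMatrix P π i i / π i - 1 := by
  have hp := (hπ.pos hi hs i).ne'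
  have h := congrFun (hπ.vecMul_fundamentalMatrix hi hs) i
  simp only [vecMul, dotProduct] at h
  simp only [dotProduct, meanHitting]
  rw [Finset.sum_congr rfl fun k _ => show π k * ((fundamentalMatrix P π i i -
        fundamentalMatrix P π k i) / π i) = (π k * fundamentalMatrix P π i i -
        π k * fundamentalMatrix P π k i) / π i by ring,
      ← Finset.sum_div, Finset.sum_sub_distrib, ← Finset.sum_mul, hπ.sum_eq_one, h]
  field_simp

theorem le_mulVec_of_le (hs : P ∈ rowStochastic ℝ V) {x : V → ℝ} {c : ℝ} (hc : ∀ j, c ≤ x j)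
    (j : V) : c ≤ (P *ᵥ x) j := by
  simp only [mulVec, dotProduct]
  calc c = ∑ k, P j k * c := by
        rw [← Finset.sum_mul, sum_row_of_mem_rowStochastic hs j, one_mul]
    _ ≤ _ := Finset.sum_le_sum fun k _ => mul_le_mul_of_nonneg_left (hc k) (hs.1 j k)

/-- Minimum principle: off `i`, `P g = g - 1`, so a minimum cannot be attained there; at `i` the
value is zero. -/
theorem IsStationaryDistribution.meanHitting_nonneg (hi : P.IsIrreducible)
    (hs : P ∈ rowStochastic ℝ V) (hπ : IsStationaryDistribution P π) (i j : V) :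
    0 ≤ meanHitting P π i j := by
  obtain ⟨k, -, hk⟩ := Finset.exists_min_image Finset.univ (meanHitting P π i)
    ⟨i, Finset.mem_univ i⟩
  by_cases hki : k = i
  · have := hk j (Finset.mem_univ j)
    rwa [hki, meanHitting_self] at this
  · have h1 := le_mulVec_of_le hs (fun j => hk j (Finset.mem_univ j)) k
    rw [hπ.mulVec_meanHitting hi hs, if_neg hki] at h1
    linarith

theorem IsStationaryDistribution.one_le_meanHitting (hi : P.IsIrreducible)
    (hs : P ∈ rowStochastic ℝ V) (hπ : IsStationaryDistribution P π) {i j : V} (hj : j ≠ i) :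
    1 ≤ meanHitting P π i j := by
  have h1 := le_mulVec_of_le hs (hπ.meanHitting_nonneg hi hs i) j
  rw [hπ.mulVec_meanHitting hi hs, if_neg hj] at h1
  linarith

end LinearAlgebra

/-! ### The Markov property for functionals of finite histories. -/

section MarkovProperty

variable {V : Type*} [Fintype V] [DecidableEq V] [MeasurableSpace V] [MeasurableSingletonClass V]
  {Ω : Type*} [MeasurableSpace Ω] {μ : Measure Ω} {P : Matrix V V ℝ} {m : ℕ → Ω → V}

/-- A functional of finitely many coordinates factors through a finite set; measurability,
boundedness and integrability all follow from this. -/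
theorem measurable_of_dependsOn {V : Type*} [Finite V] [MeasurableSpace V]
    [MeasurableSingletonClass V] {m : ℕ → Ω → V} (hm : ∀ t, Measurable (m t))
    {Φ : (ℕ → V) → ℝ} {n : ℕ} (hΦ : DependsOn Φ (Set.Iic n)) :
    Measurable fun ω => Φ fun t => m t ω := by
  obtain ⟨g, rfl⟩ := dependsOn_iff_exists_comp.1 hΦ
  exact (measurable_of_finite g).comp (measurable_pi_lambda _ fun s => hm s)

theorem exists_abs_le_of_dependsOn {V : Type*} [Finite V] {Φ : (ℕ → V) → ℝ} {n : ℕ}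
    (hΦ : DependsOn Φ (Set.Iic n)) : ∃ C, ∀ x, |Φ x| ≤ C := by
  obtain ⟨g, rfl⟩ := dependsOn_iff_exists_comp.1 hΦ
  obtain ⟨C, hC⟩ := (Set.finite_range fun y => |g y|).bddAbove
  exact ⟨C, fun x => hC ⟨_, rfl⟩⟩

theorem integrable_of_dependsOn {V : Type*} [Finite V] [MeasurableSpace V]
    [MeasurableSingletonClass V] {m : ℕ → Ω → V} [IsFiniteMeasure μ] (hm : ∀ t, Measurable (m t))
    {Φ : (ℕ → V) → ℝ} {n : ℕ} (hΦ : DependsOn Φ (Set.Iic n)) :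
    Integrable (fun ω => Φ fun t => m t ω) μ := by
  obtain ⟨C, hC⟩ := exists_abs_le_of_dependsOn hΦ
  exact Integrable.of_bound (measurable_of_dependsOn hm hΦ).aestronglyMeasurable C
    (ae_of_all _ fun ω => hC _)

/-- The Markov property, for functionals of the history up to time `t` and the next state. -/
theorem IsMarkovChain.integral_eq [IsFiniteMeasure μ] (hm : IsMarkovChain P m μ) (t : ℕ)
    (Ψ : (ℕ → V) → V → ℝ) (hΨ : ∀ j, DependsOn (fun x => Ψ x j) (Set.Iic t)) :
    ∫ ω, Ψ (fun s => m s ω) (m (t + 1) ω) ∂μ =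
      ∫ ω, ∑ j, P (m t ω) j * Ψ (fun s => m s ω) j ∂μ := by
  classical
  set X : Ω → (Set.Iic t → V) := fun ω s => m s ω with hX
  have hXm : Measurable X := measurable_pi_lambda _ fun s => hm.measurable s
  have hB : ∀ z, MeasurableSet (X ⁻¹' {z}) := fun z => hXm (measurableSet_singleton z)
  have hU : ⋃ z, X ⁻¹' {z} = Set.univ := by ext; simp
  have hdisj : Pairwise (Function.onFun Disjoint fun z => X ⁻¹' {z}) := fun z z' h =>
    Set.disjoint_left.2 fun ω h1 h2 => h (by simp_all)
  have hsplit : ∀ f : Ω → ℝ, Integrable f μ → ∫ ω, f ω ∂μ = ∑ z, ∫ ω in X ⁻¹' {z}, f ω ∂μ := by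
    intro f hf
    rw [← integral_iUnion_fintype hB hdisj fun z => hf.integrableOn, hU, setIntegral_univ]
  have hI1 : Integrable (fun ω => Ψ (fun s => m s ω) (m (t + 1) ω)) μ := by
    refine integrable_of_dependsOn (n := t + 1) (Φ := fun x => Ψ x (x (t + 1))) hm.measurable
      fun x y h => ?_
    simp only [h (t + 1) (by simp)]
    exact hΨ _ fun s hs => h s (Set.mem_Iic.2 (Nat.le_succ_of_le hs))
  have hI2 : Integrable (fun ω => ∑ j, P (m t ω) j * Ψ (fun s => m s ω) j) μ := by
    refine integrable_of_dependsOn (n := t) (Φ := fun x => ∑ j, P (x t) j * Ψ x j) hm.measurable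
      fun x y h => ?_
    refine Finset.sum_congr rfl fun j _ => ?_
    rw [h t (by simp)]
    exact congrArg _ (hΨ j h)
  rw [hsplit _ hI1, hsplit _ hI2]
  refine Finset.sum_congr rfl fun z _ => ?_
  -- An extension of the history `z` to all times; its values after `t` are irrelevant.
  set e : ℕ → V := fun s => if h : s ≤ t then z ⟨s, h⟩ else z ⟨t, Set.mem_Iic.2 le_rfl⟩ with he
  have hmem : ∀ ω, ω ∈ X ⁻¹' {z} ↔ ∀ s ≤ t, m s ω = e s := by
    intro ω
    simp only [Set.mem_preimage, Set.mem_singleton_iff, hX, funext_iff, Subtype.forall, he]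
    refine forall_congr' fun s => forall_congr' fun hs => ?_
    rw [dif_pos (Set.mem_Iic.1 hs)]
  have hL : ∫ ω in X ⁻¹' {z}, Ψ (fun s => m s ω) (m (t + 1) ω) ∂μ =
      ∫ ω in X ⁻¹' {z}, ∑ j, Ψ e j * (m (t + 1) ⁻¹' {j}).indicator 1 ω ∂μ := by
    refine setIntegral_congr_fun (hB z) fun ω hω => ?_
    have h1 := (hmem ω).1 hω
    simp only [Set.indicator_apply, Set.mem_preimage, Set.mem_singleton_iff, Pi.one_apply,
      mul_ite, mul_one, mul_zero, Finset.sum_ite_eq, Finset.mem_univ, if_true]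
    exact hΨ _ fun s hs => h1 s hs
  have hR : ∫ ω in X ⁻¹' {z}, ∑ j, P (m t ω) j * Ψ (fun s => m s ω) j ∂μ =
      ∫ ω in X ⁻¹' {z}, ∑ j, P (e t) j * Ψ e j ∂μ := by
    refine setIntegral_congr_fun (hB z) fun ω hω => ?_
    have h1 := (hmem ω).1 hω
    refine Finset.sum_congr rfl fun j _ => ?_
    rw [h1 t le_rfl]
    exact congrArg _ (hΨ j fun s hs => h1 s hs)
  rw [hL, hR, setIntegral_const, smul_eq_mul, Finset.mul_sum, integral_finsetSum]
  · refine Finset.sum_congr rfl fun j _ => ?_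
    have hmj : MeasurableSet (m (t + 1) ⁻¹' {j}) := hm.measurable _ (measurableSet_singleton j)
    rw [integral_const_mul, integral_indicator_one hmj, measureReal_restrict_apply hmj]
    -- The defining product formula, for the path that follows `z` up to `t` and then jumps to `j`.
    have htr := hm.transition t (Function.update e (t + 1) j)
    have e1 : {ω | ∀ s ≤ t + 1, m s ω = Function.update e (t + 1) j s} =
        m (t + 1) ⁻¹' {j} ∩ X ⁻¹' {z} := by
      ext ω
      rw [Set.mem_inter_iff, hmem]
      simp only [Set.mem_ofPred_eq, Set.mem_preimage, Set.mem_singleton_iff]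
      constructor
      · intro h
        refine ⟨by simpa using h (t + 1) le_rfl, fun s hs => ?_⟩
        rw [h s (by omega), Function.update_of_ne (by omega)]
      · rintro ⟨h1, h2⟩ s hs
        rcases eq_or_ne s (t + 1) with rfl | hne
        · simpa using h1
        · rw [Function.update_of_ne hne, h2 s (by omega)]
    have e2 : {ω | ∀ s ≤ t, m s ω = Function.update e (t + 1) j s} = X ⁻¹' {z} := by
      ext ω
      rw [hmem]
      refine forall_congr' fun s => forall_congr' fun hs => ?_
      rw [Function.update_of_ne (by omega)]
    rw [e1, e2, Function.update_self, Function.update_of_ne (by omega)] at htr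
    rw [htr]
    ring
  · intro j _
    refine Integrable.const_mul ?_ _
    exact (integrable_const (1 : ℝ)).indicator (hm.measurable _ (measurableSet_singleton j))

open Matrix in
/-- A weighted increment `c (h(m(t+1)) - (P h)(m(t)))` with `c` a functional of the history has mean
zero. -/
theorem IsMarkovChain.integral_mul_sub_eq_zero [IsFiniteMeasure μ] (hm : IsMarkovChain P m μ)
    (hs : P ∈ rowStochastic ℝ V) (t : ℕ) (h : V → ℝ) {Φ : (ℕ → V) → ℝ}
    (hΦ : DependsOn Φ (Set.Iic t)) :
    ∫ ω, Φ (fun s => m s ω) * (h (m (t + 1) ω) - (P *ᵥ h) (m t ω)) ∂μ = 0 := by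
  rw [hm.integral_eq t (fun x j => Φ x * (h j - (P *ᵥ h) (x t)))]
  · refine (integral_congr_ae (ae_of_all _ fun ω => ?_)).trans (integral_zero _ _)
    have h1 : (P *ᵥ h) (m t ω) = ∑ j, P (m t ω) j * h j := rfl
    calc ∑ j, P (m t ω) j * (Φ (fun s => m s ω) * (h j - (P *ᵥ h) (m t ω)))
        = Φ (fun s => m s ω) * (∑ j, P (m t ω) j * h j -
            (∑ j, P (m t ω) j) * (P *ᵥ h) (m t ω)) := by
          rw [Finset.sum_mul, ← Finset.sum_sub_distrib, Finset.mul_sum]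
          exact Finset.sum_congr rfl fun j _ => by ring
      _ = 0 := by rw [sum_row_of_mem_rowStochastic hs, ← h1]; ring
  · intro j x y hxy
    simp only
    rw [hΦ hxy, hxy t (by simp)]

end MarkovProperty

/-! ### Strong law for orthogonal variables. -/

section LawOfLargeNumbers

variable {Ω : Type*} [MeasurableSpace Ω] {μ : Measure Ω}

/-- `∑ Y n ^ 2` has finite integral, so it is almost everywhere finite and its terms tend to zero.
-/
theorem ae_tendsto_zero_of_summable_integral_sq {Y : ℕ → Ω → ℝ} (hY : ∀ n, MemLp (Y n) 2 μ)
    {b : ℕ → ℝ} (hb : Summable b) (hYb : ∀ n, ∫ ω, Y n ω ^ 2 ∂μ ≤ b n) :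
    ∀ᵐ ω ∂μ, Tendsto (fun n => Y n ω) atTop (𝓝 0) := by
  have hint : ∀ n, Integrable (fun ω => Y n ω ^ 2) μ := fun n => (hY n).integrable_sq
  have hm : ∀ n, AEMeasurable (fun ω => ENNReal.ofReal (Y n ω ^ 2)) μ := fun n =>
    (hint n).aemeasurable.ennreal_ofReal
  have hfin : ∫⁻ ω, ∑' n, ENNReal.ofReal (Y n ω ^ 2) ∂μ ≠ ⊤ := by
    rw [lintegral_tsum hm]
    refine ne_top_of_le_ne_top hb.tsum_ofReal_ne_top (ENNReal.tsum_le_tsum fun n => ?_)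
    rw [← ofReal_integral_eq_lintegral_ofReal (hint n) (ae_of_all _ fun ω => sq_nonneg _)]
    exact ENNReal.ofReal_le_ofReal (hYb n)
  filter_upwards [ae_lt_top' (AEMeasurable.tsum hm) hfin] with ω hω
  have h1 := ENNReal.tendsto_atTop_zero_of_tsum_ne_top hω.ne
  have h2 := (ENNReal.tendsto_toReal ENNReal.zero_ne_top).comp h1
  have h3 : Tendsto (fun n => Y n ω ^ 2) atTop (𝓝 0) := by
    refine (h2.congr fun n => ?_)
    simp [ENNReal.toReal_ofReal (sq_nonneg _)]
  have h4 := h3.sqrt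
  rw [Real.sqrt_zero] at h4
  simp only [Real.sqrt_sq_eq_abs] at h4
  exact (tendsto_zero_iff_abs_tendsto_zero _).2 h4

theorem summable_const_div_succ_sq (C : ℝ) : Summable fun n : ℕ => C / ((n : ℝ) + 1) ^ 2 := by
  have h := (summable_nat_add_iff 1).2 (Real.summable_one_div_nat_pow.2 (by norm_num : 1 < 2))
  refine (h.mul_left C).congr fun n => ?_
  push_cast
  ring

/-- Variables with bounded second moments are almost surely `o(n)`. -/
theorem ae_tendsto_div_of_integral_sq_le {X : ℕ → Ω → ℝ} (hX : ∀ n, MemLp (X n) 2 μ)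
    {C : ℝ} (hC : ∀ n, ∫ ω, X n ω ^ 2 ∂μ ≤ C) :
    ∀ᵐ ω ∂μ, Tendsto (fun n => X n ω / ((n : ℝ) + 1)) atTop (𝓝 0) := by
  refine ae_tendsto_zero_of_summable_integral_sq (Y := fun n ω => X n ω / ((n : ℝ) + 1))
    (fun n => ?_) (summable_const_div_succ_sq C) fun n => ?_
  · simpa only [div_eq_inv_mul] using (hX n).const_mul ((n : ℝ) + 1)⁻¹
  · simp only [div_pow]
    rw [integral_div]
    gcongr
    exact hC n

/-- The second moment of a sum of orthogonal variables. -/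
theorem integral_sum_sq_le {D : ℕ → Ω → ℝ} (hD : ∀ n, MemLp (D n) 2 μ)
    (horth : ∀ s t, s < t → ∫ ω, D s ω * D t ω ∂μ = 0) {C : ℝ}
    (hC : ∀ n, ∫ ω, D n ω ^ 2 ∂μ ≤ C) (T : ℕ) :
    ∫ ω, (∑ t ∈ Finset.range T, D t ω) ^ 2 ∂μ ≤ C * T := by
  induction T with
  | zero => simp
  | succ T ih =>
    have hS : MemLp (fun ω => ∑ t ∈ Finset.range T, D t ω) 2 μ := memLp_finsetSum _ fun t _ => hD t
    have h0 : ∫ ω, (∑ t ∈ Finset.range T, D t ω) * D T ω ∂μ = 0 := by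
      simp only [Finset.sum_mul]
      have hi : ∀ t, Integrable (fun ω => D t ω * D T ω) μ := fun t => (hD t).integrable_mul (hD T)
      rw [integral_finsetSum _ fun t _ => hi t]
      exact Finset.sum_eq_zero fun t ht => horth t T (Finset.mem_range.1 ht)
    have h1 : ∀ ω, (∑ t ∈ Finset.range (T + 1), D t ω) ^ 2 =
        (∑ t ∈ Finset.range T, D t ω) ^ 2 + 2 * ((∑ t ∈ Finset.range T, D t ω) * D T ω) +
          D T ω ^ 2 := fun ω => by rw [Finset.sum_range_succ]; ring
    simp only [h1]
    have hi1 := hS.integrable_sq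
    have hi2 : Integrable (fun ω => 2 * ((∑ t ∈ Finset.range T, D t ω) * D T ω)) μ :=
      (hS.integrable_mul (hD T)).const_mul 2
    have hi12 : Integrable (fun ω => (∑ t ∈ Finset.range T, D t ω) ^ 2 +
        2 * ((∑ t ∈ Finset.range T, D t ω) * D T ω)) μ := hi1.add hi2
    rw [integral_add hi12 (hD T).integrable_sq, integral_add hi1 hi2, integral_const_mul, h0]
    push_cast
    linarith [hC T]

theorem integral_sum_abs_sq_le {D : ℕ → Ω → ℝ} (hD : ∀ n, MemLp (D n) 2 μ) {C : ℝ}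
    (hC : ∀ n, ∫ ω, D n ω ^ 2 ∂μ ≤ C) (s : Finset ℕ) :
    ∫ ω, (∑ t ∈ s, |D t ω|) ^ 2 ∂μ ≤ C * (s.card : ℝ) ^ 2 := by
  have hint : ∀ t, Integrable (fun ω => D t ω ^ 2) μ := fun t => (hD t).integrable_sq
  calc ∫ ω, (∑ t ∈ s, |D t ω|) ^ 2 ∂μ ≤ ∫ ω, s.card * ∑ t ∈ s, D t ω ^ 2 ∂μ := by
        refine integral_mono_of_nonneg (ae_of_all _ fun ω => sq_nonneg _)
          ((integrable_finsetSum _ fun t _ => hint t).const_mul _) (ae_of_all _ fun ω => ?_)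
        simpa only [sq_abs] using sq_sum_le_card_mul_sum_sq (s := s) (f := fun t => |D t ω|)
    _ = s.card * ∑ t ∈ s, ∫ ω, D t ω ^ 2 ∂μ := by
        rw [integral_const_mul, integral_finsetSum _ fun t _ => hint t]
    _ ≤ s.card * ∑ t ∈ s, C := by gcongr with t _; exact hC t
    _ = C * (s.card : ℝ) ^ 2 := by rw [Finset.sum_const, nsmul_eq_mul]; ring

/-- A strong law of large numbers for orthogonal variables with bounded second moments. -/
theorem ae_tendsto_sum_div_of_orthogonal {D : ℕ → Ω → ℝ} (hD : ∀ n, MemLp (D n) 2 μ)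
    (horth : ∀ s t, s < t → ∫ ω, D s ω * D t ω ∂μ = 0) {C : ℝ}
    (hC : ∀ n, ∫ ω, D n ω ^ 2 ∂μ ≤ C) :
    ∀ᵐ ω ∂μ, Tendsto (fun T : ℕ => (∑ t ∈ Finset.range T, D t ω) / (T : ℝ)) atTop (𝓝 0) := by
  have hC0 : 0 ≤ C := (integral_nonneg fun ω => sq_nonneg _).trans (hC 0)
  -- Along the squares: the partial sum up to `(n + 1) ^ 2`, divided by `n + 1`, has second moment
  -- at most `C`.
  have h1 := ae_tendsto_div_of_integral_sq_le (μ := μ) (C := C)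
    (X := fun n ω => (∑ t ∈ Finset.range ((n + 1) ^ 2), D t ω) / ((n : ℝ) + 1))
    (fun n => by
      simpa only [div_eq_inv_mul] using (memLp_finsetSum _ fun t _ => hD t).const_mul _)
    (fun n => by
      simp only [div_pow]
      rw [integral_div, div_le_iff₀ (by positivity)]
      exact_mod_cast integral_sum_sq_le hD horth hC ((n + 1) ^ 2))
  -- Between consecutive squares: a block has at most `3 * (n + 1)` terms, whence the factor 9.
  have h2 := ae_tendsto_div_of_integral_sq_le (μ := μ) (C := C * 9)
    (X := fun n ω => (∑ t ∈ Finset.Ico ((n + 1) ^ 2) ((n + 2) ^ 2), |D t ω|) / ((n : ℝ) + 1))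
    (fun n => by
      simpa only [div_eq_inv_mul] using
        (memLp_finsetSum (f := fun t ω => |D t ω|) _ fun t _ => (hD t).abs).const_mul _)
    (fun n => by
      simp only [div_pow]
      rw [integral_div, div_le_iff₀ (by positivity)]
      refine (integral_sum_abs_sq_le hD hC _).trans ?_
      rw [Nat.card_Ico, mul_assoc]
      refine mul_le_mul_of_nonneg_left ?_ hC0
      have : (n + 2) ^ 2 - (n + 1) ^ 2 ≤ 3 * (n + 1) := by
        rw [tsub_le_iff_right]; nlinarith
      have h3 : (((n + 2) ^ 2 - (n + 1) ^ 2 : ℕ) : ℝ) ≤ 3 * (n + 1) := by exact_mod_cast this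
      calc _ ≤ (3 * ((n : ℝ) + 1)) ^ 2 := by gcongr
        _ = _ := by ring)
  filter_upwards [h1, h2] with ω hω1 hω2
  have hlim := hω1.abs.add hω2
  simp only [abs_zero, add_zero] at hlim
  have hsqrt : Tendsto (fun T : ℕ => T.sqrt - 1) atTop atTop := by
    refine (tendsto_sub_atTop_nat 1).comp (tendsto_atTop.2 fun b => ?_)
    filter_upwards [eventually_ge_atTop (b * b)] with T hT
    exact Nat.le_sqrt.2 hT
  -- With `T.sqrt = n + 1`, the sum up to `T` is at most the sum up to the square plus the block,
  -- and `T ≥ (n + 1) ^ 2`.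
  refine squeeze_zero_norm' ?_ (hlim.comp hsqrt)
  filter_upwards [eventually_ge_atTop 1] with T hT
  obtain ⟨n, hn⟩ : ∃ n, T.sqrt = n + 1 := ⟨T.sqrt - 1, by
    have : 0 < T.sqrt := Nat.sqrt_pos.2 hT
    omega⟩
  have hle : (n + 1) ^ 2 ≤ T := by rw [← hn]; exact Nat.sqrt_le' T
  have hlt : T < (n + 2) ^ 2 := by simpa [hn] using Nat.lt_succ_sqrt' T
  simp only [Function.comp_apply, hn, Nat.add_sub_cancel, Real.norm_eq_abs]
  have hsum : |∑ t ∈ Finset.range T, D t ω| ≤ |∑ t ∈ Finset.range ((n + 1) ^ 2), D t ω| +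
      ∑ t ∈ Finset.Ico ((n + 1) ^ 2) ((n + 2) ^ 2), |D t ω| := by
    rw [← Finset.sum_range_add_sum_Ico _ hle]
    refine (abs_add_le _ _).trans (add_le_add_right ?_ _)
    refine (Finset.abs_sum_le_sum_abs _ _).trans
      (Finset.sum_le_sum_of_subset_of_nonneg (Finset.Ico_subset_Ico_right hlt.le)
        fun t _ _ => abs_nonneg _)
  have hn1 : (0 : ℝ) < (n : ℝ) + 1 := by positivity
  have hT' : ((n : ℝ) + 1) * ((n : ℝ) + 1) ≤ T := by
    have : (((n + 1) ^ 2 : ℕ) : ℝ) ≤ T := by exact_mod_cast hle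
    push_cast at this
    nlinarith
  rw [abs_div, Nat.abs_cast, abs_div, abs_div, abs_of_pos hn1, div_div, div_div, ← add_div]
  gcongr

end LawOfLargeNumbers

/-! ### Deterministic identities and estimates along a path. -/

section Paths

open Matrix

variable {V : Type*} [DecidableEq V] {a : V → ℝ} {i : V}

theorem age_succ (x : ℕ → V) (a : V → ℝ) (i : V) (t : ℕ) :
    age x a i (t + 1) = if x t = i then 1 else age x a i t + 1 := rfl

theorem age_congr {x y : ℕ → V} {t : ℕ} (h : ∀ s < t, x s = y s) :
    age x a i t = age y a i t := by
  induction t with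
  | zero => rfl
  | succ t ih => rw [age_succ, age_succ, h t (by omega), ih fun s hs => h s (by omega)]

/-- Predictability: the age at `t + 1` is fixed by the history up to `t`, so it may weight the
increment from `t` to `t + 1`. -/
theorem dependsOn_age_succ (a : V → ℝ) (i : V) (t : ℕ) :
    DependsOn (fun x => age x a i (t + 1)) (Set.Iic t) := fun _ _ h =>
  age_congr fun s hs => h s (Set.mem_Iic.2 (by omega))

theorem dependsOn_age (a : V → ℝ) (i : V) (t : ℕ) :
    DependsOn (fun x => age x a i t) (Set.Iic t) := fun _ _ h =>
  age_congr fun s hs => h s (Set.mem_Iic.2 (by omega))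

theorem abs_age_le (x : ℕ → V) (a : V → ℝ) (i : V) (t : ℕ) : |age x a i t| ≤ |a i| + t := by
  induction t with
  | zero => simp [age]
  | succ t ih =>
    rw [age_succ]
    push_cast
    split_ifs
    · rw [abs_one]
      linarith [abs_nonneg (a i), (Nat.cast_nonneg t : (0 : ℝ) ≤ t)]
    · refine (abs_add_le _ _).trans ?_
      rw [abs_one]
      linarith

/-- The number of visits to `i` at the times `1, …, T`. -/
noncomputable def visits (x : ℕ → V) (i : V) (T : ℕ) : ℝ :=
  ∑ t ∈ Finset.Icc 1 T, if x t = i then 1 else 0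

theorem visits_nonneg (x : ℕ → V) (i : V) (T : ℕ) : 0 ≤ visits x i T :=
  Finset.sum_nonneg fun t _ => by split_ifs <;> norm_num

/-- The sum of the age peaks telescopes. -/
theorem sum_peaks (x : ℕ → V) (a : V → ℝ) (i : V) (T : ℕ) :
    (∑ t ∈ Finset.Icc 1 T, if x t = i then age x a i t else 0) =
      T + age x a i 1 - age x a i (T + 1) := by
  induction T with
  | zero => simp
  | succ T ih =>
    rw [Finset.sum_Icc_succ_top (by omega), ih, age_succ x a i (T + 1)]
    push_cast
    split_ifs <;> ring

theorem peakAverage_eq (x : ℕ → V) (a : V → ℝ) (i : V) (T : ℕ) :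
    peakAverage x a i T = (T + age x a i 1 - age x a i (T + 1)) / visits x i T := by
  rw [← sum_peaks]; rfl

/-- A crude linear bound, valid also without visits; it will be multiplied by an exponentially small
factor. -/
theorem abs_peakAverage_le (x : ℕ → V) (a : V → ℝ) (i : V) (T : ℕ) :
    |peakAverage x a i T| ≤ |a i| + T := by
  change |(∑ t ∈ Finset.Icc 1 T, if x t = i then age x a i t else 0) / visits x i T| ≤ _
  rw [abs_div, abs_of_nonneg (visits_nonneg x i T)]
  refine div_le_of_le_mul₀ (visits_nonneg x i T) (by positivity) ?_
  refine (Finset.abs_sum_le_sum_abs _ _).trans ?_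
  rw [visits, Finset.mul_sum]
  refine Finset.sum_le_sum fun t ht => ?_
  have hT : (t : ℝ) ≤ T := by exact_mod_cast (Finset.mem_Icc.1 ht).2
  split_ifs
  · rw [mul_one]; linarith [abs_age_le x a i t]
  · simp

variable [Fintype V] {P : Matrix V V ℝ} {π : V → ℝ}

/-- The sum of the weighted increments `c t * (h(x(t+1)) - (P h)(x(t)))` along the path `x`. -/
noncomputable def incrementSum (P : Matrix V V ℝ) (h : V → ℝ) (c : ℕ → (ℕ → V) → ℝ) (x : ℕ → V)
    (T : ℕ) : ℝ :=
  ∑ t ∈ Finset.range T, c t x * (h (x (t + 1)) - (P *ᵥ h) (x t))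

/-- The equation of `g` is summed over the times `0, …, T`; the last term removes the visit at time
0, which `visits` does not count. -/
theorem visits_eq (hi : P.IsIrreducible) (hs : P ∈ rowStochastic ℝ V)
    (hπ : IsStationaryDistribution P π) (x : ℕ → V) (i : V) (T : ℕ) :
    visits x i T = π i * ((T + 1 : ℝ) + meanHitting P π i (x (T + 1)) - meanHitting P π i (x 0) -
      incrementSum P (meanHitting P π i) (fun _ _ => 1) x (T + 1)) -
        if x 0 = i then 1 else 0 := by
  have hp := (hπ.pos hi hs i).ne'
  induction T with
  | zero =>
    rw [show visits x i 0 = 0 by simp [visits]]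
    simp only [incrementSum, hπ.mulVec_meanHitting hi hs, Finset.sum_range_succ,
      Finset.sum_range_zero, Nat.cast_zero, zero_add, one_mul]
    split_ifs
    · field_simp
      ring
    · ring
  | succ T ih =>
    rw [visits, Finset.sum_Icc_succ_top (by omega), ← visits, ih]
    rw [incrementSum, incrementSum, Finset.sum_range_succ _ (T + 1),
      hπ.mulVec_meanHitting hi hs _ (x (T + 1))]
    push_cast
    split_ifs <;> field_simp <;> ring

/-- The corrector `h` with `(1 - P) h = P g - π g`, where `g` is the mean hitting time of `i`. -/
noncomputable def corrector (P : Matrix V V ℝ) (π : V → ℝ) (i : V) : V → ℝ :=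
  fundamentalMatrix P π *ᵥ (P *ᵥ meanHitting P π i)

/-- The first martingale comes from replacing `g (x (t + 1))` by `(P g) (x t)`, the second from the
Poisson equation for `P g`. -/
theorem sum_age_eq (hi : P.IsIrreducible) (hs : P ∈ rowStochastic ℝ V)
    (hπ : IsStationaryDistribution P π) (x : ℕ → V) (a : V → ℝ) (i : V) (T : ℕ) :
    ∑ t ∈ Finset.Icc 1 T, age x a i t = T * (fundamentalMatrix P π i i / π i) +
      (age x a i 0 * meanHitting P π i (x 0) - age x a i T * meanHitting P π i (x T)) +
      (corrector P π i (x 0) - corrector P π i (x T)) +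
      incrementSum P (meanHitting P π i) (fun t x => age x a i (t + 1)) x T +
      incrementSum P (corrector P π i) (fun _ _ => 1) x T := by
  induction T with
  | zero => simp [incrementSum]
  | succ T ih =>
    rw [Finset.sum_Icc_succ_top (by omega), ih]
    have h1 := hπ.poisson hi hs (P *ᵥ meanHitting P π i) (x T)
    rw [dotProduct_mulVec, hπ.stationary, hπ.dotProduct_meanHitting hi hs, ← corrector] at h1
    have h2 := hπ.mulVec_meanHitting hi hs i (x T)
    rw [incrementSum, incrementSum, incrementSum, incrementSum, Finset.sum_range_succ _ T,
      Finset.sum_range_succ _ T]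
    push_cast
    -- At `i` the age becomes 1 and `g` vanishes; elsewhere `1 + P g = g`.
    have h3 : age x a i (T + 1) * (1 + (P *ᵥ meanHitting P π i) (x T)) =
        age x a i T * meanHitting P π i (x T) + 1 + (P *ᵥ meanHitting P π i) (x T) := by
      rw [age_succ]
      split_ifs with hx
      · rw [hx, meanHitting_self]; ring
      · rw [h2, if_neg hx]; ring
    linear_combination h3 - h1

theorem exists_abs_le {V : Type*} [Fintype V] (h : V → ℝ) : ∃ K, 1 ≤ K ∧ ∀ j, |h j| ≤ K := by
  refine ⟨1 + ∑ j, |h j|, ?_, fun j => ?_⟩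
  · linarith [Finset.sum_nonneg fun j (_ : j ∈ Finset.univ) => abs_nonneg (h j)]
  · linarith [Finset.single_le_sum (f := fun j => |h j|) (fun j _ => abs_nonneg _)
      (Finset.mem_univ j)]

theorem tendsto_bounded_div {u : ℕ → ℝ} {K : ℝ} (hu : ∀ n, |u n| ≤ K) :
    Tendsto (fun T : ℕ => u T / (T : ℝ)) atTop (𝓝 0) := by
  refine squeeze_zero_norm (fun T => ?_) (tendsto_const_div_atTop_nhds_zero_nat K)
  rw [Real.norm_eq_abs, abs_div, Nat.abs_cast]
  exact div_le_div_of_nonneg_right (hu T) (Nat.cast_nonneg T)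

theorem tendsto_timeAverage (hi : P.IsIrreducible) (hs : P ∈ rowStochastic ℝ V)
    (hπ : IsStationaryDistribution P π) {x : ℕ → V}
    (hage : Tendsto (fun T : ℕ => age x a i T / ((T : ℝ) + 1)) atTop (𝓝 0))
    (h1 : Tendsto (fun T : ℕ => incrementSum P (meanHitting P π i)
      (fun t x => age x a i (t + 1)) x T / (T : ℝ)) atTop (𝓝 0))
    (h2 : Tendsto (fun T : ℕ => incrementSum P (corrector P π i) (fun _ _ => 1) x T / (T : ℝ))
      atTop (𝓝 0)) :
    Tendsto (timeAverage x a i) atTop (𝓝 (fundamentalMatrix P π i i / π i)) := by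
  obtain ⟨K, -, hK⟩ := exists_abs_le (meanHitting P π i)
  obtain ⟨L, -, hL⟩ := exists_abs_le (corrector P π i)
  have h3 := tendsto_bounded_div (u := fun T => corrector P π i (x 0) - corrector P π i (x T))
    (K := L + L) fun T => (abs_sub _ _).trans (add_le_add (hL _) (hL _))
  have h4 := tendsto_const_div_atTop_nhds_zero_nat (age x a i 0 * meanHitting P π i (x 0))
  have h5 : Tendsto (fun T : ℕ => age x a i T * meanHitting P π i (x T) / (T : ℝ)) atTop
      (𝓝 0) := by
    have h6 := (hage.abs.mul_const (2 * K))
    rw [abs_zero, zero_mul] at h6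
    refine squeeze_zero_norm' ?_ h6
    filter_upwards [eventually_ge_atTop 1] with T hT
    have hT' : (1 : ℝ) ≤ T := by exact_mod_cast hT
    rw [Real.norm_eq_abs, abs_div, abs_mul, Nat.abs_cast, abs_div,
      abs_of_pos (by positivity : (0 : ℝ) < T + 1), div_mul_eq_mul_div,
      div_le_div_iff₀ (by positivity) (by positivity)]
    have h7 : |meanHitting P π i (x T)| * ((T : ℝ) + 1) ≤ 2 * K * T := by
      have := hK (x T)
      have h0 := abs_nonneg (meanHitting P π i (x T))
      nlinarith
    have := mul_le_mul_of_nonneg_left h7 (abs_nonneg (age x a i T))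
    linarith
  have h := (((((tendsto_const_nhds (x := fundamentalMatrix P π i i / π i)).add
    (h4.sub h5)).add h3).add h1).add h2)
  simp only [sub_zero, add_zero] at h
  refine h.congr' ?_
  filter_upwards [eventually_ge_atTop 1] with T hT
  have hT' : (T : ℝ) ≠ 0 := by positivity
  rw [timeAverage, sum_age_eq hi hs hπ]
  generalize fundamentalMatrix P π i i / π i = c
  field_simp

theorem tendsto_visits_div (hi : P.IsIrreducible) (hs : P ∈ rowStochastic ℝ V)
    (hπ : IsStationaryDistribution P π) {x : ℕ → V}
    (h1 : Tendsto (fun T : ℕ => incrementSum P (meanHitting P π i) (fun _ _ => 1) x T / (T : ℝ))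
      atTop (𝓝 0)) :
    Tendsto (fun T : ℕ => visits x i T / ((T : ℝ) + 1)) atTop (𝓝 (π i)) := by
  obtain ⟨K, -, hK⟩ := exists_abs_le (meanHitting P π i)
  have h2 := tendsto_bounded_div (u := fun T => meanHitting P π i (x T) - meanHitting P π i (x 0))
    (K := K + K) fun T => (abs_sub _ _).trans (add_le_add (hK _) (hK _))
  have h3 := tendsto_const_div_atTop_nhds_zero_nat (if x 0 = i then (1 : ℝ) else 0)
  have h := ((((tendsto_const_nhds (x := (1 : ℝ))).add h2).sub h1).const_mul (π i)).sub h3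
  simp only [sub_zero, add_zero, mul_one] at h
  refine (h.comp (tendsto_add_atTop_nat 1)).congr fun T => ?_
  have hT : (T : ℝ) + 1 ≠ 0 := by positivity
  simp only [Function.comp_apply]
  rw [visits_eq hi hs hπ]
  push_cast
  generalize (if x 0 = i then (1 : ℝ) else 0) = c
  field_simp
  ring

theorem tendsto_peakAverage (hi : P.IsIrreducible) (hs : P ∈ rowStochastic ℝ V)
    (hπ : IsStationaryDistribution P π) {x : ℕ → V}
    (hage : Tendsto (fun T : ℕ => age x a i T / ((T : ℝ) + 1)) atTop (𝓝 0))
    (h1 : Tendsto (fun T : ℕ => visits x i T / ((T : ℝ) + 1)) atTop (𝓝 (π i))) :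
    Tendsto (peakAverage x a i) atTop (𝓝 (1 / π i)) := by
  have hp := (hπ.pos hi hs i).ne'
  have h2 := hage.comp (tendsto_add_atTop_nat 1)
  have h3 := (tendsto_const_div_atTop_nhds_zero_nat (age x a i 1)).comp (tendsto_add_atTop_nat 1)
  have h4 : Tendsto (fun T : ℕ => ((T : ℝ) + 1 + 1) / ((T : ℝ) + 1)) atTop (𝓝 1) := by
    have := (tendsto_const_nhds (x := (1 : ℝ))).add (tendsto_one_div_add_atTop_nhds_zero_nat (𝕜 := ℝ))
    rw [add_zero] at this
    refine this.congr fun T => ?_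
    have hT : (T : ℝ) + 1 ≠ 0 := by positivity
    field_simp
  have h5 := (tendsto_const_nhds (x := (1 : ℝ))).sub
    (tendsto_one_div_add_atTop_nhds_zero_nat (𝕜 := ℝ))
  have h := ((h5.add h3).sub (h2.mul h4)).div h1 hp
  simp only [sub_zero, add_zero, zero_mul] at h
  refine h.congr fun T => ?_
  have hT : (T : ℝ) + 1 ≠ 0 := by positivity
  have hT2 : (T : ℝ) + 1 + 1 ≠ 0 := by positivity
  simp only [Pi.div_apply, Function.comp_apply]
  rw [peakAverage_eq, ← div_div_div_cancel_right₀ hT _ (visits x i T)]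
  congr 1
  push_cast
  field_simp
  ring

/-- Lyapunov drift of `A² g`. With `δ = 1 / (2 * K)`, `(A + 1)² ≤ (1 + δ) A² + 1 + 1 / δ`; off `i`
the mean of `g` drops by 1, and `(1 + δ) (g - 1) ≤ (1 - δ) g` because `2 δ g = g / K ≤ 1`. At `i`
the age resets and only a constant remains. -/
theorem sq_age_succ_mul_le (hi : P.IsIrreducible) (hs : P ∈ rowStochastic ℝ V)
    (hπ : IsStationaryDistribution P π) (x : ℕ → V) (a : V → ℝ) (i : V) (t : ℕ) {K : ℝ}
    (hK1 : 1 ≤ K) (hK : ∀ j, meanHitting P π i j ≤ K) :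
    age x a i (t + 1) ^ 2 * (P *ᵥ meanHitting P π i) (x t) ≤
      (1 - 1 / (2 * K)) * (age x a i t ^ 2 * meanHitting P π i (x t)) +
        ((1 + 2 * K) * K + 1 / π i) := by
  have hp := hπ.pos hi hs i
  have hp' : 0 < 1 / π i := by positivity
  rw [hπ.mulVec_meanHitting hi hs, age_succ]
  split_ifs with hx
  · rw [hx, meanHitting_self]
    nlinarith
  · have hg1 := hπ.one_le_meanHitting hi hs hx
    have hgK := hK (x t)
    generalize meanHitting P π i (x t) = g at *
    generalize age x a i t = A
    have hδ : (A + 1) ^ 2 ≤ (1 + 1 / (2 * K)) * A ^ 2 + (1 + 2 * K) := by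
      have h0 : 0 ≤ (A - 2 * K) ^ 2 / (2 * K) := by positivity
      have : (1 + 1 / (2 * K)) * A ^ 2 + (1 + 2 * K) - (A + 1) ^ 2 = (A - 2 * K) ^ 2 / (2 * K) := by
        field_simp
        ring
      linarith
    have h1 : (1 + 1 / (2 * K)) * (g - 1) ≤ (1 - 1 / (2 * K)) * g := by
      have h2 : g / K ≤ 1 := (div_le_one (by linarith)).2 hgK
      have h3 : 0 < 1 / (2 * K) := by positivity
      have h4 : (1 - 1 / (2 * K)) * g - (1 + 1 / (2 * K)) * (g - 1) =
        1 - g / K + 1 / (2 * K) := by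
        field_simp
        ring
      linarith
    calc (A + 1) ^ 2 * (g - 1 + 0)
        ≤ ((1 + 1 / (2 * K)) * A ^ 2 + (1 + 2 * K)) * (g - 1) := by
          rw [add_zero]
          exact mul_le_mul_of_nonneg_right hδ (by linarith)
      _ = (1 + 1 / (2 * K)) * (g - 1) * A ^ 2 + (1 + 2 * K) * (g - 1) := by ring
      _ ≤ (1 - 1 / (2 * K)) * g * A ^ 2 + (1 + 2 * K) * K := by
          refine add_le_add (mul_le_mul_of_nonneg_right h1 (sq_nonneg A)) ?_
          exact mul_le_mul_of_nonneg_left (by linarith) (by linarith)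
      _ ≤ _ := by linarith

/-- Few visits up to time `T` force the martingale of the visits to be large. -/
theorem sub_le_incrementSum_of_visits_lt (hi : P.IsIrreducible)
    (hs : P ∈ rowStochastic ℝ V) (hπ : IsStationaryDistribution P π) {i : V} {K : ℝ}
    (hK : ∀ j, meanHitting P π i j ≤ K) {x : ℕ → V} {T : ℕ}
    (hx : visits x i T < π i * ((T + 1 : ℝ) / 2)) :
    0 ≤ incrementSum P (meanHitting P π i) (fun _ _ => 1) x (T + 1) - (T + 1 : ℝ) / 2 +
      (K + 1 / π i) := by
  have hp := hπ.pos hi hs i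
  rw [visits_eq hi hs hπ] at hx
  have h0 : (if x 0 = i then (1 : ℝ) else 0) ≤ π i * (1 / π i) := by
    rw [mul_one_div_cancel hp.ne']
    split_ifs <;> norm_num
  have h1 := hπ.meanHitting_nonneg hi hs i (x (T + 1))
  have h2 := hK (x 0)
  have h3 : (T + 1 : ℝ) + meanHitting P π i (x (T + 1)) - meanHitting P π i (x 0) -
      incrementSum P (meanHitting P π i) (fun _ _ => 1) x (T + 1) - 1 / π i < (T + 1 : ℝ) / 2 := by
    refine lt_of_mul_lt_mul_left ?_ hp.le
    rw [mul_sub _ _ (1 / π i)]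
    linarith
  linarith

/-- Supplies the dominating constant on the event of many visits. -/
theorem abs_peakAverage_le_of_le_visits {V : Type*} [DecidableEq V] {x : ℕ → V} {a : V → ℝ} {i : V}
    {T : ℕ} {p : ℝ} (hp : 0 < p) (hx : p * ((T + 1 : ℝ) / 2) ≤ visits x i T) :
    |peakAverage x a i T| ≤ (4 + 4 * |a i|) / p := by
  have hT : (0 : ℝ) ≤ T := Nat.cast_nonneg T
  have ha := abs_nonneg (a i)
  have hv : 0 < visits x i T := lt_of_lt_of_le (by positivity) hx
  rw [peakAverage_eq, abs_div, abs_of_pos hv, div_le_div_iff₀ hv hp]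
  have h1 := abs_age_le x a i 1
  have h2 := abs_age_le x a i (T + 1)
  push_cast at h1 h2
  have h3 : |(T : ℝ) + age x a i 1 - age x a i (T + 1)| ≤ (2 + 2 * |a i|) * ((T : ℝ) + 1) := by
    rw [abs_le] at *
    constructor <;> nlinarith
  calc _ ≤ (2 + 2 * |a i|) * ((T : ℝ) + 1) * p := mul_le_mul_of_nonneg_right h3 hp.le
    _ = (4 + 4 * |a i|) * (p * ((T + 1 : ℝ) / 2)) := by ring
    _ ≤ _ := mul_le_mul_of_nonneg_left hx (by linarith)

end Paths

/-! ### Moment bounds for the age and the martingales. -/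

section Moments

open Matrix

variable {V : Type*} [Fintype V] [DecidableEq V] [MeasurableSpace V] [MeasurableSingletonClass V]
  {Ω : Type*} [MeasurableSpace Ω] {μ : Measure Ω} [IsProbabilityMeasure μ]
  {P : Matrix V V ℝ} {π : V → ℝ} {m : ℕ → Ω → V}

theorem dependsOn_increment {V : Type*} [Fintype V] {P : Matrix V V ℝ} {t : ℕ} (h : V → ℝ)
    {c : (ℕ → V) → ℝ} (hc : DependsOn c (Set.Iic t)) :
    DependsOn (fun x => c x * (h (x (t + 1)) - (P *ᵥ h) (x t))) (Set.Iic (t + 1)) := by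
  intro x y hxy
  simp only [hxy (t + 1) (by simp), hxy t (by simp)]
  rw [hc fun s hs => hxy s (Set.mem_Iic.2 (Nat.le_succ_of_le hs))]

theorem memLp_two_of_dependsOn {V : Type*} [Finite V] [MeasurableSpace V]
    [MeasurableSingletonClass V] {m : ℕ → Ω → V} (hm : ∀ t, Measurable (m t)) {Φ : (ℕ → V) → ℝ} {n : ℕ}
    (hΦ : DependsOn Φ (Set.Iic n)) : MemLp (fun ω => Φ fun t => m t ω) 2 μ := by
  obtain ⟨C, hC⟩ := exists_abs_le_of_dependsOn hΦ
  exact MemLp.of_bound (measurable_of_dependsOn hm hΦ).aestronglyMeasurable C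
    (ae_of_all _ fun ω => hC _)

/-- The strong law for the martingale of the weighted increments of `h` along the chain. -/
theorem IsMarkovChain.ae_tendsto_incrementSum_div (hm : IsMarkovChain P m μ)
    (hs : P ∈ rowStochastic ℝ V) (h : V → ℝ) {c : ℕ → (ℕ → V) → ℝ}
    (hc : ∀ t, DependsOn (c t) (Set.Iic t)) {C : ℝ}
    (hC : ∀ t, ∫ ω, c t (fun s => m s ω) ^ 2 ∂μ ≤ C) :
    ∀ᵐ ω ∂μ, Tendsto (fun T : ℕ => incrementSum P h c (fun s => m s ω) T / (T : ℝ)) atTop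
      (𝓝 0) := by
  obtain ⟨K, hK1, hK⟩ := exists_abs_le h
  obtain ⟨L, hL1, hL⟩ := exists_abs_le (P *ᵥ h)
  refine ae_tendsto_sum_div_of_orthogonal (C := (K + L) ^ 2 * C)
    (D := fun t ω => c t (fun s => m s ω) * (h (m (t + 1) ω) - (P *ᵥ h) (m t ω)))
    (fun t => memLp_two_of_dependsOn hm.measurable (dependsOn_increment h (hc t)))
    (fun s t hst => ?_) fun t => ?_
  -- Orthogonality: the earlier increment times `c t` is a functional of the history up to `t`.
  · simp only [← mul_assoc]
    refine hm.integral_mul_sub_eq_zero hs t h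
      (Φ := fun x => c s x * (h (x (s + 1)) - (P *ᵥ h) (x s)) * c t x) fun x y hxy => ?_
    have h1 := dependsOn_increment (P := P) h (hc s) (x := x) (y := y)
      fun r hr => hxy r (Set.mem_Iic.2 ((Set.mem_Iic.1 hr).trans hst))
    simp only at h1 ⊢
    rw [h1, hc t hxy]
  · refine le_trans ?_ (mul_le_mul_of_nonneg_left (hC t) (sq_nonneg (K + L)))
    rw [← integral_const_mul]
    refine integral_mono_of_nonneg (ae_of_all _ fun ω => sq_nonneg _)
      (((memLp_two_of_dependsOn hm.measurable (hc t)).integrable_sq).const_mul _)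
      (ae_of_all _ fun ω => ?_)
    simp only [mul_pow]
    rw [mul_comm]
    refine mul_le_mul_of_nonneg_right ?_ (sq_nonneg _)
    exact sq_le_sq' (by linarith [neg_le_of_abs_le (hK (m (t + 1) ω)), le_of_abs_le (hL (m t ω))])
      (by linarith [neg_le_of_abs_le (hL (m t ω)), le_of_abs_le (hK (m (t + 1) ω))])

theorem IsMarkovChain.integral_incrementSum (hm : IsMarkovChain P m μ)
    (hs : P ∈ rowStochastic ℝ V) (h : V → ℝ) {c : ℕ → (ℕ → V) → ℝ}
    (hc : ∀ t, DependsOn (c t) (Set.Iic t)) (T : ℕ) :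
    ∫ ω, incrementSum P h c (fun s => m s ω) T ∂μ = 0 := by
  simp only [incrementSum]
  rw [integral_finsetSum _ fun t _ =>
    integrable_of_dependsOn hm.measurable (dependsOn_increment h (hc t))]
  exact Finset.sum_eq_zero fun t _ => hm.integral_mul_sub_eq_zero hs t h (hc t)

/-- The drift inequality makes `W t`, the mean of `A² g`, a contraction up to the constant `E`, so
it stays below `W 0 + 2 * K * E`. -/
theorem exists_integral_sq_age_le (hm : IsMarkovChain P m μ) (hi : P.IsIrreducible)
    (hs : P ∈ rowStochastic ℝ V) (hπ : IsStationaryDistribution P π) (a : V → ℝ) (i : V) :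
    ∃ C, ∀ t, ∫ ω, age (fun s => m s ω) a i t ^ 2 ∂μ ≤ C := by
  obtain ⟨K, hK1, hK⟩ := exists_abs_le (meanHitting P π i)
  have hp := hπ.pos hi hs i
  have hg0 := hπ.meanHitting_nonneg hi hs i
  set E : ℝ := (1 + 2 * K) * K + 1 / π i with hE
  have hE0 : 0 ≤ E := by positivity
  set W : ℕ → ℝ := fun t =>
    ∫ ω, age (fun s => m s ω) a i t ^ 2 * meanHitting P π i (m t ω) ∂μ with hW
  have hdep : ∀ t, DependsOn (fun x => age x a i t ^ 2 * meanHitting P π i (x t)) (Set.Iic t) := by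
    intro t x y h
    have := dependsOn_age a i t h
    simp only at this ⊢
    rw [this, h t (by simp)]
  have hint : ∀ t, Integrable
      (fun ω => age (fun s => m s ω) a i t ^ 2 * meanHitting P π i (m t ω)) μ := fun t =>
    integrable_of_dependsOn hm.measurable (hdep t)
  have hW0 : ∀ t, 0 ≤ W t := fun t => integral_nonneg fun ω => mul_nonneg (sq_nonneg _) (hg0 _)
  have hstep : ∀ t, W (t + 1) ≤ (1 - 1 / (2 * K)) * W t + E := by
    intro t
    have hdep1 : DependsOn (fun x => age x a i (t + 1) ^ 2) (Set.Iic t) := fun x y h => by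
      have := dependsOn_age_succ a i t h
      simp only at this ⊢
      rw [this]
    have hint1 : Integrable (fun ω => age (fun s => m s ω) a i (t + 1) ^ 2 *
        (P *ᵥ meanHitting P π i) (m t ω)) μ := by
      refine integrable_of_dependsOn (n := t) (Φ := fun x => age x a i (t + 1) ^ 2 *
        (P *ᵥ meanHitting P π i) (x t)) hm.measurable fun x y h => ?_
      have := hdep1 h
      simp only at this ⊢
      rw [this, h t (by simp)]
    -- Predictability of the age lets `g (m (t + 1))` be replaced by `(P g) (m t)` under the
    -- integral.
    have h0 := hm.integral_mul_sub_eq_zero hs t (meanHitting P π i) hdep1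
    simp only [mul_sub] at h0
    rw [integral_sub (hint (t + 1)) hint1, sub_eq_zero] at h0
    calc W (t + 1) = _ := h0
      _ ≤ ∫ ω, ((1 - 1 / (2 * K)) *
            (age (fun s => m s ω) a i t ^ 2 * meanHitting P π i (m t ω)) + E) ∂μ :=
          integral_mono hint1 (((hint t).const_mul _).add (integrable_const _)) fun ω =>
            sq_age_succ_mul_le hi hs hπ (fun s => m s ω) a i t hK1 fun j => le_of_abs_le (hK j)
      _ = _ := by
          rw [integral_add ((hint t).const_mul _) (integrable_const _), integral_const_mul]
          simp [hW]
  have hbound : ∀ t, W t ≤ W 0 + 2 * K * E := by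
    intro t
    induction t with
    | zero => linarith [mul_nonneg (by linarith : (0 : ℝ) ≤ 2 * K) hE0]
    | succ t ih =>
      have h1 : 1 / (2 * K) ≤ 1 := (div_le_one (by linarith)).2 (by linarith)
      have h2 : 0 ≤ 1 / (2 * K) * W 0 := mul_nonneg (by positivity) (hW0 0)
      have h3 : 1 / (2 * K) * (2 * K * E) = E := by field_simp
      have h4 := mul_le_mul_of_nonneg_left ih (sub_nonneg.2 h1)
      linarith [hstep t]
  refine ⟨a i ^ 2 + (2 * (W 0 + 2 * K * E) + 2), fun t => ?_⟩
  have hB : 0 ≤ W 0 + 2 * K * E := (hW0 0).trans (hbound 0)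
  cases t with
  | zero => simp [age]; linarith
  | succ t =>
    -- The zero of `g` at `i` is harmless: the next age is then 1; elsewhere `g ≥ 1`.
    have hpt : ∀ x : ℕ → V, age x a i (t + 1) ^ 2 ≤
        2 * (age x a i t ^ 2 * meanHitting P π i (x t)) + 2 := by
      intro x
      rw [age_succ]
      split_ifs with hx
      · rw [hx, meanHitting_self]; norm_num
      · have h1 := mul_le_mul_of_nonneg_left (hπ.one_le_meanHitting hi hs hx)
          (sq_nonneg (age x a i t))
        nlinarith [sq_nonneg (age x a i t - 1)]
    calc ∫ ω, age (fun s => m s ω) a i (t + 1) ^ 2 ∂μ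
        ≤ ∫ ω, (2 * (age (fun s => m s ω) a i t ^ 2 * meanHitting P π i (m t ω)) + 2) ∂μ :=
          integral_mono_of_nonneg (ae_of_all _ fun ω => sq_nonneg _)
            (((hint t).const_mul _).add (integrable_const _)) (ae_of_all _ fun ω => hpt _)
      _ = 2 * W t + 2 := by
          rw [integral_add ((hint t).const_mul _) (integrable_const _), integral_const_mul]
          simp [hW]
      _ ≤ _ := by linarith [hbound t, sq_nonneg (a i)]

/-- The exponential moments of the martingale of the increments of `h`. -/
theorem IsMarkovChain.integral_exp_incrementSum_le (hm : IsMarkovChain P m μ)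
    (hs : P ∈ rowStochastic ℝ V) {h : V → ℝ} {K l : ℝ} (hl : 0 ≤ l) (hlK : l * K ≤ 1)
    (hK : ∀ j k, |h j - (P *ᵥ h) k| ≤ K) (T : ℕ) :
    ∫ ω, Real.exp (l * incrementSum P h (fun _ _ => 1) (fun s => m s ω) T) ∂μ ≤
      Real.exp (l ^ 2 * K ^ 2) ^ T := by
  have hdep : ∀ T, DependsOn (fun x => incrementSum P h (fun _ _ => 1) x T) (Set.Iic T) := by
    intro T x y hxy
    refine Finset.sum_congr rfl fun t ht => ?_
    have ht := Finset.mem_range.1 ht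
    rw [hxy t (Set.mem_Iic.2 ht.le), hxy (t + 1) (Set.mem_Iic.2 ht)]
  induction T with
  | zero => simp [incrementSum]
  | succ T ih =>
    have h1 : ∀ x : ℕ → V, Real.exp (l * incrementSum P h (fun _ _ => 1) x (T + 1)) =
        Real.exp (l * incrementSum P h (fun _ _ => 1) x T) *
          Real.exp (l * (h (x (T + 1)) - (P *ᵥ h) (x T))) := fun x => by
      rw [← Real.exp_add, show incrementSum P h (fun _ _ => 1) x (T + 1) =
        incrementSum P h (fun _ _ => 1) x T + 1 * (h (x (T + 1)) - (P *ᵥ h) (x T)) from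
        Finset.sum_range_succ _ _, one_mul, mul_add]
    simp only [h1]
    rw [hm.integral_eq T (fun x j => Real.exp (l * incrementSum P h (fun _ _ => 1) x T) *
      Real.exp (l * (h j - (P *ᵥ h) (x T))))]
    · rw [pow_succ, mul_comm]
      refine le_trans ?_ (mul_le_mul_of_nonneg_left ih (Real.exp_nonneg _))
      rw [← integral_const_mul]
      refine integral_mono_of_nonneg (ae_of_all _ fun ω => Finset.sum_nonneg fun j _ =>
        mul_nonneg (hs.1 _ _) (by positivity)) (Integrable.const_mul ?_ _)
        (ae_of_all _ fun ω => ?_)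
      · refine integrable_of_dependsOn (n := T) (Φ := fun x =>
          Real.exp (l * incrementSum P h (fun _ _ => 1) x T)) hm.measurable fun x y hxy => ?_
        have := hdep T hxy
        simp only at this ⊢
        rw [this]
      · simp only
        generalize incrementSum P h (fun _ _ => 1) (fun s => m s ω) T = S
        have hrow := sum_row_of_mem_rowStochastic hs (m T ω)
        -- `exp u ≤ 1 + u + u²` for `|u| ≤ 1`, which is why `l * K ≤ 1` is assumed; the linear term
        -- averages to zero below.
        have hexp : ∀ j, Real.exp (l * (h j - (P *ᵥ h) (m T ω))) ≤
            1 + l * (h j - (P *ᵥ h) (m T ω)) + l ^ 2 * K ^ 2 := by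
          intro j
          have hb := hK j (m T ω)
          have hb2 : |l * (h j - (P *ᵥ h) (m T ω))| ≤ l * K := by
            rw [abs_mul, abs_of_nonneg hl]
            exact mul_le_mul_of_nonneg_left hb hl
          have h2 := Real.abs_exp_sub_one_sub_id_le (hb2.trans hlK)
          have h3 : (l * (h j - (P *ᵥ h) (m T ω))) ^ 2 ≤ (l * K) ^ 2 :=
            sq_le_sq' (neg_le_of_abs_le hb2) (le_of_abs_le hb2)
          have := le_of_abs_le h2
          nlinarith
        have hP : (P *ᵥ h) (m T ω) = ∑ j, P (m T ω) j * h j := rfl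
        calc ∑ j, P (m T ω) j * (Real.exp (l * S) * Real.exp (l * (h j - (P *ᵥ h) (m T ω))))
            ≤ ∑ j, P (m T ω) j * (Real.exp (l * S) *
                (1 + l * (h j - (P *ᵥ h) (m T ω)) + l ^ 2 * K ^ 2)) := by
              refine Finset.sum_le_sum fun j _ => mul_le_mul_of_nonneg_left ?_ (hs.1 _ _)
              exact mul_le_mul_of_nonneg_left (hexp j) (Real.exp_nonneg _)
          _ = Real.exp (l * S) * ((∑ j, P (m T ω) j) * (1 + l ^ 2 * K ^ 2 -
                l * (P *ᵥ h) (m T ω)) + l * ∑ j, P (m T ω) j * h j) := by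
              rw [Finset.sum_mul, Finset.mul_sum, ← Finset.sum_add_distrib, Finset.mul_sum]
              exact Finset.sum_congr rfl fun j _ => by ring
          _ = Real.exp (l * S) * (l ^ 2 * K ^ 2 + 1) := by rw [hrow, ← hP]; ring
          _ ≤ Real.exp (l * S) * Real.exp (l ^ 2 * K ^ 2) :=
              mul_le_mul_of_nonneg_left (Real.add_one_le_exp _) (Real.exp_nonneg _)
          _ = _ := mul_comm _ _
    · intro j x y hxy
      have := hdep T hxy
      simp only at this ⊢
      rw [this, hxy T (by simp)]

end Moments

/-! ### Almost sure limits and limits of expectations. -/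

section Limits

open Matrix

variable {V : Type*} [Fintype V] [DecidableEq V] [MeasurableSpace V] [MeasurableSingletonClass V]
  {Ω : Type*} [MeasurableSpace Ω] {μ : Measure Ω} [IsProbabilityMeasure μ]
  {P : Matrix V V ℝ} {π : V → ℝ} {m : ℕ → Ω → V}

theorem dependsOn_const_Iic {V : Type*} (c : ℝ) (t : ℕ) :
    DependsOn (fun _ : ℕ → V => c) (Set.Iic t) := fun _ _ _ => rfl

theorem ae_tendsto_age_div (hm : IsMarkovChain P m μ) (hi : P.IsIrreducible)
    (hs : P ∈ rowStochastic ℝ V) (hπ : IsStationaryDistribution P π) (a : V → ℝ) (i : V) :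
    ∀ᵐ ω ∂μ, Tendsto (fun T : ℕ => age (fun s => m s ω) a i T / ((T : ℝ) + 1)) atTop (𝓝 0) := by
  obtain ⟨C, hC⟩ := exists_integral_sq_age_le hm hi hs hπ a i
  exact ae_tendsto_div_of_integral_sq_le
    (fun t => memLp_two_of_dependsOn hm.measurable (dependsOn_age a i t)) hC

theorem ae_tendsto_incrementSum_one_div (hm : IsMarkovChain P m μ) (hs : P ∈ rowStochastic ℝ V)
    (h : V → ℝ) :
    ∀ᵐ ω ∂μ, Tendsto (fun T : ℕ => incrementSum P h (fun _ _ => 1) (fun s => m s ω) T / (T : ℝ))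
      atTop (𝓝 0) :=
  hm.ae_tendsto_incrementSum_div hs h (fun t => dependsOn_const_Iic 1 t) (C := 1) (by simp)

theorem ae_tendsto_timeAverage (hm : IsMarkovChain P m μ) (hi : P.IsIrreducible)
    (hs : P ∈ rowStochastic ℝ V) (hπ : IsStationaryDistribution P π) (a : V → ℝ) (i : V) :
    ∀ᵐ ω ∂μ, Tendsto (timeAverage (fun s => m s ω) a i) atTop
      (𝓝 (fundamentalMatrix P π i i / π i)) := by
  obtain ⟨C, hC⟩ := exists_integral_sq_age_le hm hi hs hπ a i
  filter_upwards [ae_tendsto_age_div hm hi hs hπ a i,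
    hm.ae_tendsto_incrementSum_div hs (meanHitting P π i) (c := fun t x => age x a i (t + 1))
      (dependsOn_age_succ a i) (fun t => hC (t + 1)),
    ae_tendsto_incrementSum_one_div hm hs (corrector P π i)] with ω h1 h2 h3
  exact tendsto_timeAverage hi hs hπ h1 h2 h3

theorem ae_tendsto_visits_div (hm : IsMarkovChain P m μ) (hi : P.IsIrreducible)
    (hs : P ∈ rowStochastic ℝ V) (hπ : IsStationaryDistribution P π) (i : V) :
    ∀ᵐ ω ∂μ, Tendsto (fun T : ℕ => visits (fun s => m s ω) i T / ((T : ℝ) + 1)) atTop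
      (𝓝 (π i)) := by
  filter_upwards [ae_tendsto_incrementSum_one_div hm hs (meanHitting P π i)] with ω h
  exact tendsto_visits_div hi hs hπ h

theorem ae_tendsto_peakAverage (hm : IsMarkovChain P m μ) (hi : P.IsIrreducible)
    (hs : P ∈ rowStochastic ℝ V) (hπ : IsStationaryDistribution P π) (a : V → ℝ) (i : V) :
    ∀ᵐ ω ∂μ, Tendsto (peakAverage (fun s => m s ω) a i) atTop (𝓝 (1 / π i)) := by
  filter_upwards [ae_tendsto_age_div hm hi hs hπ a i, ae_tendsto_visits_div hm hi hs hπ i]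
    with ω h1 h2
  exact tendsto_peakAverage hi hs hπ h1 h2

theorem dependsOn_incrementSum {V : Type*} [Fintype V] (P : Matrix V V ℝ) (h : V → ℝ)
    {c : ℕ → (ℕ → V) → ℝ} (hc : ∀ t, DependsOn (c t) (Set.Iic t)) (T : ℕ) :
    DependsOn (fun x => incrementSum P h c x T) (Set.Iic T) := fun _ _ hxy =>
  Finset.sum_congr rfl fun t ht => dependsOn_increment h (hc t) fun s hs =>
    hxy s (Set.mem_Iic.2 ((Set.mem_Iic.1 hs).trans (Finset.mem_range.1 ht)))

/-- Both martingales in `sum_age_eq` have mean zero, and the boundary terms `R` have bounded mean by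
the second moment bound. -/
theorem tendsto_integral_timeAverage (hm : IsMarkovChain P m μ) (hi : P.IsIrreducible)
    (hs : P ∈ rowStochastic ℝ V) (hπ : IsStationaryDistribution P π) (a : V → ℝ) (i : V) :
    Tendsto (fun T : ℕ => ∫ ω, timeAverage (fun s => m s ω) a i T ∂μ) atTop
      (𝓝 (fundamentalMatrix P π i i / π i)) := by
  obtain ⟨C, hC⟩ := exists_integral_sq_age_le hm hi hs hπ a i
  obtain ⟨K, hK1, hK⟩ := exists_abs_le (meanHitting P π i)
  obtain ⟨L, -, hL⟩ := exists_abs_le (corrector P π i)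
  set R : ℕ → (ℕ → V) → ℝ := fun T x =>
    (age x a i 0 * meanHitting P π i (x 0) - age x a i T * meanHitting P π i (x T)) +
      (corrector P π i (x 0) - corrector P π i (x T)) with hR
  have hRdep : ∀ T, DependsOn (R T) (Set.Iic T) := by
    intro T x y h
    have h1 := dependsOn_age a i T h
    simp only at h1
    simp only [hR]
    rw [h1, h T (by simp), h 0 (by simp)]
    rfl
  have hRint : ∀ T, Integrable (fun ω => R T fun s => m s ω) μ := fun T =>
    integrable_of_dependsOn hm.measurable (hRdep T)
  have hI1 : ∀ T, Integrable (fun ω => incrementSum P (meanHitting P π i)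
      (fun t x => age x a i (t + 1)) (fun s => m s ω) T) μ := fun T =>
    integrable_of_dependsOn hm.measurable (dependsOn_incrementSum P _ (dependsOn_age_succ a i) T)
  have hI2 : ∀ T, Integrable (fun ω => incrementSum P (corrector P π i)
      (fun _ _ => 1) (fun s => m s ω) T) μ := fun T =>
    integrable_of_dependsOn hm.measurable
      (dependsOn_incrementSum P _ (fun t => dependsOn_const_Iic 1 t) T)
  have hmean : ∀ T, ∫ ω, ∑ t ∈ Finset.Icc 1 T, age (fun s => m s ω) a i t ∂μ =
      T * (fundamentalMatrix P π i i / π i) + ∫ ω, R T (fun s => m s ω) ∂μ := by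
    intro T
    have h1 : ∀ ω, ∑ t ∈ Finset.Icc 1 T, age (fun s => m s ω) a i t =
        (((T * (fundamentalMatrix P π i i / π i) + R T (fun s => m s ω)) +
        incrementSum P (meanHitting P π i) (fun t x => age x a i (t + 1)) (fun s => m s ω) T) +
        incrementSum P (corrector P π i) (fun _ _ => 1) (fun s => m s ω) T) := fun ω => by
      rw [sum_age_eq hi hs hπ]
      simp only [hR]
      ring
    simp only [h1]
    have e1 : Integrable (fun ω => T * (fundamentalMatrix P π i i / π i) +
      R T (fun s => m s ω)) μ := (integrable_const _).add (hRint T)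
    have e2 : Integrable (fun ω => T * (fundamentalMatrix P π i i / π i) + R T (fun s => m s ω) +
      incrementSum P (meanHitting P π i) (fun t x => age x a i (t + 1)) (fun s => m s ω) T) μ :=
      e1.add (hI1 T)
    rw [integral_add e2 (hI2 T), integral_add e1 (hI1 T), integral_add (integrable_const _) (hRint T),
      hm.integral_incrementSum hs _ (dependsOn_age_succ a i),
      hm.integral_incrementSum hs _ (fun t => dependsOn_const_Iic 1 t)]
    simp
  have hRle : ∀ T, |∫ ω, R T (fun s => m s ω) ∂μ| ≤ |a i| * K + (1 + C) * K + (L + L) := by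
    intro T
    have hsq : Integrable (fun ω => age (fun s => m s ω) a i T ^ 2) μ :=
      (memLp_two_of_dependsOn hm.measurable (dependsOn_age a i T)).integrable_sq
    have hdom : Integrable (fun ω => K * age (fun s => m s ω) a i T ^ 2 +
        (|a i| * K + K + (L + L))) μ := (hsq.const_mul K).add (integrable_const _)
    calc |∫ ω, R T (fun s => m s ω) ∂μ| ≤ ∫ ω, |R T (fun s => m s ω)| ∂μ :=
          abs_integral_le_integral_abs
      _ ≤ ∫ ω, (K * age (fun s => m s ω) a i T ^ 2 + (|a i| * K + K + (L + L))) ∂μ := by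
          refine integral_mono (hRint T).abs hdom fun ω => ?_
          simp only [hR]
          refine (abs_add_le _ _).trans ?_
          have h1 := (abs_sub (corrector P π i (m 0 ω)) (corrector P π i (m T ω))).trans
            (add_le_add (hL _) (hL _))
          have h2 := abs_sub (age (fun s => m s ω) a i 0 * meanHitting P π i (m 0 ω))
            (age (fun s => m s ω) a i T * meanHitting P π i (m T ω))
          rw [abs_mul, abs_mul] at h2
          have h3 := mul_le_mul_of_nonneg_left (hK (m 0 ω)) (abs_nonneg (a i))
          have h4 := mul_le_mul_of_nonneg_left (hK (m T ω))
            (abs_nonneg (age (fun s => m s ω) a i T))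
          have h5 : |age (fun s => m s ω) a i T| ≤ age (fun s => m s ω) a i T ^ 2 + 1 := by
            rw [← sq_abs]
            nlinarith [sq_nonneg (|age (fun s => m s ω) a i T| - 1)]
          have h6 := mul_le_mul_of_nonneg_right h5 (by linarith : 0 ≤ K)
          have h7 : age (fun s => m s ω) a i 0 = a i := rfl
          rw [h7] at h2 ⊢
          linarith
      _ = K * ∫ ω, age (fun s => m s ω) a i T ^ 2 ∂μ + (|a i| * K + K + (L + L)) := by
          rw [integral_add (hsq.const_mul K) (integrable_const _), integral_const_mul]
          simp
      _ ≤ _ := by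
          have := mul_le_mul_of_nonneg_left (hC T) (by linarith : 0 ≤ K)
          linarith
  have h := (tendsto_const_nhds (x := fundamentalMatrix P π i i / π i)).add
    (tendsto_bounded_div hRle)
  rw [add_zero] at h
  refine h.congr' ?_
  filter_upwards [eventually_ge_atTop 1] with T hT
  have hT' : (T : ℝ) ≠ 0 := by positivity
  simp only [timeAverage]
  rw [integral_const_mul, hmean]
  generalize fundamentalMatrix P π i i / π i = c
  field_simp

theorem dependsOn_visits {V : Type*} [DecidableEq V] (i : V) (T : ℕ) :
    DependsOn (fun x => visits x i T) (Set.Iic T) := fun _ _ h =>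
  Finset.sum_congr rfl fun t ht => by rw [h t (Set.mem_Iic.2 (Finset.mem_Icc.1 ht).2)]

theorem dependsOn_peakAverage {V : Type*} [DecidableEq V] (a : V → ℝ) (i : V) (T : ℕ) :
    DependsOn (fun x => peakAverage x a i T) (Set.Iic T) := by
  intro x y h
  have h1 : age x a i (T + 1) = age y a i (T + 1) := dependsOn_age_succ a i T h
  have h2 : age x a i 1 = age y a i 1 :=
    dependsOn_age_succ a i 0 fun s hs => h s (Set.mem_Iic.2 ((Set.mem_Iic.1 hs).trans T.zero_le))
  have h3 : visits x i T = visits y i T := dependsOn_visits i T h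
  simp only [peakAverage_eq, h1, h2, h3]

theorem tendsto_integral_peakAverage (hm : IsMarkovChain P m μ) (hi : P.IsIrreducible)
    (hs : P ∈ rowStochastic ℝ V) (hπ : IsStationaryDistribution P π) (a : V → ℝ) (i : V) :
    Tendsto (fun T : ℕ => ∫ ω, peakAverage (fun s => m s ω) a i T ∂μ) atTop (𝓝 (1 / π i)) := by
  have hp := hπ.pos hi hs i
  have hg0 := hπ.meanHitting_nonneg hi hs i
  obtain ⟨K, hK1, hK⟩ := exists_abs_le (meanHitting P π i)
  have hK' : ∀ j, meanHitting P π i j ≤ K := fun j => le_of_abs_le (hK j)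
  -- Truncation to at least half the expected number of visits, where the peak average is bounded.
  set q : ℕ → (ℕ → V) → ℝ := fun T x =>
    if π i * ((T + 1 : ℝ) / 2) ≤ visits x i T then peakAverage x a i T else 0 with hq
  have hqdep : ∀ T, DependsOn (q T) (Set.Iic T) := by
    intro T x y h
    have h1 := dependsOn_visits i T h
    have h2 := dependsOn_peakAverage a i T h
    simp only at h1 h2
    simp only [hq, h1, h2]
  have hqlim : Tendsto (fun T => ∫ ω, q T (fun s => m s ω) ∂μ) atTop (𝓝 (1 / π i)) := by
    have h1 := tendsto_integral_of_dominated_convergence (μ := μ)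
      (F := fun T ω => q T fun s => m s ω) (f := fun _ => 1 / π i)
      (fun _ => (4 + 4 * |a i|) / π i)
      (fun T => (measurable_of_dependsOn hm.measurable (hqdep T)).aestronglyMeasurable)
      (integrable_const _) (fun T => ae_of_all _ fun ω => ?_) ?_
    · simpa using h1
    · simp only [hq, Real.norm_eq_abs]
      split_ifs with h
      · exact abs_peakAverage_le_of_le_visits hp h
      · rw [abs_zero]; positivity
    · filter_upwards [ae_tendsto_peakAverage hm hi hs hπ a i, ae_tendsto_visits_div hm hi hs hπ i]
        with ω h1 h2
      refine h1.congr' ?_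
      filter_upwards [h2.eventually (lt_mem_nhds (by linarith : π i / 2 < π i))] with T hT
      rw [lt_div_iff₀ (by positivity)] at hT
      simp only [hq]
      rw [if_pos (by linarith)]
  -- Chosen so that `l ^ 2 * K ^ 2 = l / 4`: few visits gain `-l / 2` per step in the exponent, the
  -- exponential moment costs `l / 4`, and the net rate is `log r = -l / 4`.
  set l : ℝ := 1 / (4 * K ^ 2) with hl
  have hl0 : 0 < l := by positivity
  have hlK2 : l * K ^ 2 = 1 / 4 := by rw [hl]; field_simp
  have hlK : l * K ≤ 1 := by nlinarith
  set r : ℝ := Real.exp (-(l / 4)) with hr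
  have hr1 : r < 1 := by
    rw [hr, ← Real.exp_zero]
    exact Real.exp_lt_exp.2 (by linarith)
  -- Both terms lie in `[0, K]`.
  have hd : ∀ j k, |meanHitting P π i j - (P *ᵥ meanHitting P π i) k| ≤ K := by
    intro j k
    have h1 := le_mulVec_of_le hs hg0 k
    have h2 : (P *ᵥ meanHitting P π i) k ≤ K := by
      have := le_mulVec_of_le hs (x := -meanHitting P π i) (c := -K)
        (fun j => neg_le_neg (hK' j)) k
      rw [mulVec_neg, Pi.neg_apply] at this
      linarith
    rw [abs_le]
    constructor <;> linarith [hg0 j, hK' j]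
  set B : ℝ := Real.exp (l * (K + 1 / π i)) with hB
  set S : ℕ → Ω → ℝ := fun T ω =>
    incrementSum P (meanHitting P π i) (fun _ _ => 1) (fun s => m s ω) T with hS
  have hSint : ∀ T, Integrable (fun ω => Real.exp (l * S T ω)) μ := by
    intro T
    refine integrable_of_dependsOn (n := T) (Φ := fun x => Real.exp (l *
      incrementSum P (meanHitting P π i) (fun _ _ => 1) x T)) hm.measurable fun x y h => ?_
    have := dependsOn_incrementSum P (meanHitting P π i) (fun t => dependsOn_const_Iic 1 t) T h
    simp only at this ⊢
    rw [this]
  -- Chernoff bound: on the event of few visits the product of exponentials is at least 1.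
  have hpt : ∀ T ω, |peakAverage (fun s => m s ω) a i T - q T (fun s => m s ω)| ≤
      (|a i| + T) * B * Real.exp (-(l * ((T + 1 : ℝ) / 2))) * Real.exp (l * S (T + 1) ω) := by
    intro T ω
    simp only [hq]
    split_ifs with h
    · rw [sub_self, abs_zero]; positivity
    · rw [sub_zero, mul_assoc, mul_assoc, hB, ← Real.exp_add, ← Real.exp_add]
      refine (abs_peakAverage_le _ a i T).trans ?_
      refine le_mul_of_one_le_right (by positivity) (Real.one_le_exp ?_)
      have := mul_nonneg hl0.le (sub_le_incrementSum_of_visits_lt hi hs hπ hK' (not_le.1 h))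
      simp only [hS]
      linarith
  have hint : ∀ T, Integrable (fun ω => peakAverage (fun s => m s ω) a i T) μ := fun T =>
    integrable_of_dependsOn hm.measurable (dependsOn_peakAverage a i T)
  have hqint : ∀ T, Integrable (fun ω => q T (fun s => m s ω)) μ := fun T =>
    integrable_of_dependsOn hm.measurable (hqdep T)
  have hdiff : ∀ T : ℕ, |∫ ω, peakAverage (fun s => m s ω) a i T ∂μ -
      ∫ ω, q T (fun s => m s ω) ∂μ| ≤ (|a i| + T) * B * r ^ (T + 1) := by
    intro T
    rw [← integral_sub (hint T) (hqint T)]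
    refine abs_integral_le_integral_abs.trans ?_
    refine (integral_mono ((hint T).sub (hqint T)).abs ((hSint (T + 1)).const_mul _)
      (hpt T)).trans ?_
    rw [integral_const_mul]
    have h1 := hm.integral_exp_incrementSum_le hs hl0.le hlK hd (T + 1)
    have h2 : Real.exp (-(l * ((T + 1 : ℝ) / 2))) * Real.exp (l ^ 2 * K ^ 2) ^ (T + 1) =
        r ^ (T + 1) := by
      rw [hr, ← Real.exp_nat_mul, ← Real.exp_nat_mul, ← Real.exp_add]
      congr 1
      push_cast
      linear_combination (T + 1 : ℝ) * l * hlK2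
    rw [← h2, ← mul_assoc]
    exact mul_le_mul_of_nonneg_left h1 (by positivity)
  have hzero : Tendsto (fun T : ℕ => (|a i| + T) * B * r ^ (T + 1)) atTop (𝓝 0) := by
    have h1 := tendsto_pow_atTop_nhds_zero_of_lt_one (Real.exp_nonneg _) hr1
    have h2 := tendsto_self_mul_const_pow_of_lt_one (Real.exp_nonneg _) hr1
    have h3 := (h1.const_mul (|a i| * B * r)).add (h2.const_mul (B * r))
    rw [mul_zero, mul_zero, add_zero] at h3
    refine h3.congr fun T => ?_
    rw [← hr]
    ring
  have h := (squeeze_zero_norm hdiff hzero).add hqlim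
  rw [zero_add] at h
  exact h.congr fun T => by ring

/-- Since the limits exist and are real, the upper limits are finite and the sum in `EReal` is the
real one. -/
theorem sum_coe_mul_limsup_eq {V : Type*} [Fintype V] (w : V → ℝ) (u : V → ℕ → ℝ) (c : V → ℝ)
    (h : ∀ i, Tendsto (u i) atTop (𝓝 (c i))) :
    ∑ i, (w i : EReal) * limsup (fun T => (u i T : EReal)) atTop =
      ((∑ i, w i * c i : ℝ) : EReal) := by
  have h1 : ∀ i, limsup (fun T => (u i T : EReal)) atTop = c i := fun i =>
    ((continuous_coe_real_ereal.tendsto (c i)).comp (h i)).limsup_eq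
  simp only [h1, ← EReal.coe_mul]
  exact (map_sum (⟨⟨Real.toEReal, EReal.coe_zero⟩, EReal.coe_add⟩ : ℝ →+ EReal) _ _).symm

end Limits

end AgeOfInformation

/-! ### Conclusion. -/

theorem theorem1 {V : Type*} [Fintype V] [DecidableEq V]
    [MeasurableSpace V] [MeasurableSingletonClass V]
    {Ω : Type*} [MeasurableSpace Ω] (μ : Measure Ω) [IsProbabilityMeasure μ]
    (G : Digraph V) (P : Matrix V V ℝ) (m : ℕ → Ω → V)
    (hm : AgeOfInformation.IsRandomizedTrajectory G P m μ)
    (w : V → ℝ) (hw : ∀ i, 0 < w i) (a : V → ℝ) :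
    (∃! π : V → ℝ, AgeOfInformation.IsStationaryDistribution P π) ∧
    ∀ π : V → ℝ, AgeOfInformation.IsStationaryDistribution P π →
      (∀ i, 0 < π i) ∧
      IsUnit (1 - P + AgeOfInformation.stationaryMatrix π) ∧
      -- the pathwise network peak and average age, almost surely
      (∀ᵐ ω ∂μ, AgeOfInformation.networkPeakAge w (fun t => m t ω) a =
        ((∑ i, w i / π i : ℝ) : EReal)) ∧
      (∀ᵐ ω ∂μ, AgeOfInformation.networkAverageAge w (fun t => m t ω) a =
        ((∑ i, w i * AgeOfInformation.fundamentalMatrix P π i i / π i : ℝ) : EReal)) ∧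
      -- the same, terminal by terminal, for the limits of the expectations
      (∀ i, Tendsto (fun T : ℕ =>
        ∫ ω, AgeOfInformation.peakAverage (fun t => m t ω) a i T ∂μ) atTop (𝓝 (1 / π i))) ∧
      (∀ i, Tendsto (fun T : ℕ =>
        ∫ ω, AgeOfInformation.timeAverage (fun t => m t ω) a i T ∂μ) atTop
          (𝓝 (AgeOfInformation.fundamentalMatrix P π i i / π i))) := by
  obtain ⟨hs, hi, -, hm⟩ := hm
  have : Nonempty Ω := nonempty_of_isProbabilityMeasure μ
  -- Existence of a stationary distribution fails for empty `V`; a probability space has a point,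
  -- whose path supplies a state.
  have : Nonempty V := ‹Nonempty Ω›.map (m 0)
  refine ⟨?_, fun π hπ => ⟨hπ.pos hi hs, hπ.isUnit hi hs, ?_, ?_,
    AgeOfInformation.tendsto_integral_peakAverage hm hi hs hπ a,
    AgeOfInformation.tendsto_integral_timeAverage hm hi hs hπ a⟩⟩
  · obtain ⟨π, hπ⟩ := AgeOfInformation.exists_isStationaryDistribution hs
    exact ⟨π, hπ, fun ρ hρ => hρ.unique hi hs hπ⟩
  · filter_upwards [ae_all_iff.2 (AgeOfInformation.ae_tendsto_peakAverage hm hi hs hπ a)] with ω hω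
    refine (AgeOfInformation.sum_coe_mul_limsup_eq w _ _ hω).trans ?_
    simp only [mul_one_div]
  · filter_upwards [ae_all_iff.2 (AgeOfInformation.ae_tendsto_timeAverage hm hi hs hπ a)] with ω hω
    refine (AgeOfInformation.sum_coe_mul_limsup_eq w _ _ hω).trans ?_
    simp only [mul_div_assoc]
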